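/- Let $k\in\mathbb N$, let $Q$ be a sesquilinear (Hermitian, positive definite) inner product on $\mathbb C^k$ that is real-valued on $\mathbb R^k\times\mathbb R^k$, and put $B_{1/n}=\{z\in\mathbb C^k : \sqrt{Q(z,z)}<1/n\}$ for $n\ge 1$. Let $\mathcal L$ be a countable set of nonzero linear forms on $\mathbb C^k$ with real coefficients, and let $\mathcal S_{\mathcal L}$ be the set of all products $L_1\cdots L_r$ with $r\ge 1$ and $L_i\in\mathcal L$. For $n\ge 1$ and $P\in\mathcal S_{\mathcal L}$ let $\mathrm{Mer}_P(B_{1/n})$ be the real Banach space of all fractions $h/P$, where $h$ is a bounded holomorphic function on $B_{1/n}$ with real values on $B_{1/n}\cap\mathbb R^k$, with norm $\|h/P\|=\|h\|_\infty$. Let $\mathcal M_{\mathcal L}(\mathbb C^k)=\varinjlim_{(n,P)}\mathrm{Mer}_P(B_{1/n})$ be the resulting real vector space of meromorphic germs at $0$, with the locally convex inductive limit topology (the finest locally convex vector space topology for which all the canonical maps $\mathrm{Mer}_P(B_{1/n})\to\mathcal M_{\mathcal L}(\mathbb C^k)$ are continuous). A meromorphic function $f$ on a connected open set $U\subseteq\mathbb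 C^k$ is said to depend on a subspace $V\subseteq(\mathbb C^k)^*$ if there are linear forms $L_1,\dots,L_n$ spanning $V$, a connected open set $W\subseteq\mathbb C^n$ and a meromorphic function $g$ on $W$ such that, with $\phi=(L_1,\dots,L_n)$, the set $U\cap\phi^{-1}(W)$ is nonempty and $f=g\circ\phi$ on it (as meromorphic functions). A germ at $0$ depends on $V$ if some meromorphic function on a connected open neighbourhood of $0$ representing it does. The dependence subspace $\mathrm{Dep}(f)\subseteq(\mathbb C^k)^*$ of a germ $f$ is the smallest subspace on which $f$ depends. Lemma. Let $f_1,f_2,\dots$ be a sequence in $\mathcal M_{\mathcal L}(\mathbb C^k)$ which converges to $f$ in $\mathcal M_{\mathcal L}(\mathbb C^k)$. Then for every $\ell\in\mathrm{Dep}(f)$ there are a subsequence $(f_{m_j})_{j\in\mathbb N}$ and elements $\ell_{m_j}\in\mathrm{Dep}(f_{m_j})$, $j\in\mathbb N$, such that the sequence $(\ell_{m_j})_j$ converges to $\ell$ in $(\mathbb C^k)^*$. -/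

import Mathlib

open Filter Topology

namespace LinearPoles

/-- The complex space of `k` variables. -/
abbrev Cn (k : ℕ) : Type := Fin k → ℂ

/-- The dual space of all complex linear forms on the space of `k` variables. -/
abbrev CnDual (k : ℕ) : Type := Cn k →L[ℂ] ℂ

/-- The embedding of `ℝ^k` into `ℂ^k`. -/
def realPt {k : ℕ} (x : Fin k → ℝ) : Cn k := fun i => (x i : ℂ)

/-- A (positive definite, sesquilinear) inner product on `ℂ^k` which is real on `ℝ^k × ℝ^k`. -/
def IsRealInner {k : ℕ} (Q : InnerProductSpace.Core ℂ (Cn k)) : Prop :=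
  ∀ x y : Fin k → ℝ, (Q.inner (realPt x) (realPt y)).im = 0

/-- A generating set of linear poles: countably many nonzero linear forms with real
coefficients. -/
structure IsGeneratingSet {k : ℕ} (𝓛 : Set (CnDual k)) : Prop where
  countable : 𝓛.Countable
  zero_notMem : (0 : CnDual k) ∉ 𝓛
  real : ∀ L ∈ 𝓛, ∀ x : Fin k → ℝ, (L (realPt x)).im = 0

/-- The semigroup (without unit) of all products `L₁ ⋯ L_m`, `m ≥ 1`, of members of `𝓛`. -/
def poleSemigroup {k : ℕ} (𝓛 : Set (CnDual k)) : Subsemigroup (Cn k → ℂ) :=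
  Subsemigroup.closure ((fun L : CnDual k => (L : Cn k → ℂ)) '' 𝓛)

/-- The open ball of radius `1 / n` around `0` for the norm `z ↦ √ Q(z, z)`. -/
def qBall {k : ℕ} (Q : InnerProductSpace.Core ℂ (Cn k)) (n : ℕ+) : Set (Cn k) :=
  {z | √ (Q.inner z z).re < 1 / (n : ℝ)}

open Classical in
/-- Extension by zero of a function on a subset of `ℂ^k`. -/
noncomputable def extendZero {k : ℕ} {B : Set (Cn k)} (h : B → ℂ) : Cn k → ℂ :=
  fun z => if hz : z ∈ B then h ⟨z, hz⟩ else 0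

theorem extendZero_add {k : ℕ} {B : Set (Cn k)} (h₁ h₂ : B → ℂ) :
    extendZero (h₁ + h₂) = extendZero h₁ + extendZero h₂ := by
  funext z
  by_cases hz : z ∈ B <;> simp [extendZero, hz]

theorem extendZero_smul {k : ℕ} {B : Set (Cn k)} (c : ℝ) (h : B → ℂ) :
    extendZero (c • h) = c • extendZero h := by
  funext z
  by_cases hz : z ∈ B <;> simp [extendZero, hz]

theorem extendZero_zero {k : ℕ} {B : Set (Cn k)} :
    extendZero (0 : B → ℂ) = 0 := by
  funext z
  by_cases hz : z ∈ B <;> simp [extendZero, hz]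

/-- The real Banach space of bounded holomorphic functions on the ball of radius `1 / n` which take
real values at the real points of the ball. Its norm is the supremum norm, inherited from the
bounded continuous functions on the ball. -/
noncomputable def bHol {k : ℕ} (Q : InnerProductSpace.Core ℂ (Cn k)) (n : ℕ+) :
    Submodule ℝ (BoundedContinuousFunction (qBall Q n) ℂ) where
  carrier := {h | DifferentiableOn ℂ (extendZero (h : qBall Q n → ℂ)) (qBall Q n) ∧
    ∀ x : Fin k → ℝ, ∀ hx : realPt x ∈ qBall Q n, (h ⟨realPt x, hx⟩).im = 0}
  add_mem' := by
    rintro a b ⟨ha, ha'⟩ ⟨hb, hb'⟩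
    refine ⟨?_, fun x hx => by simp [ha' x hx, hb' x hx]⟩
    rw [BoundedContinuousFunction.coe_add, extendZero_add]
    exact ha.add hb
  zero_mem' := by
    refine ⟨?_, fun x hx => by simp⟩
    rw [BoundedContinuousFunction.coe_zero, extendZero_zero]
    exact differentiableOn_const (0 : ℂ)
  smul_mem' := by
    rintro c a ⟨ha, ha'⟩
    refine ⟨?_, fun x hx => by simp [ha' x hx]⟩
    rw [BoundedContinuousFunction.coe_smul]
    change DifferentiableOn ℂ (extendZero (c • (a : qBall Q n → ℂ))) (qBall Q n)
    rw [extendZero_smul]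
    exact ha.const_smul c

/-- The filter of sets containing all points near `0` which lie off finitely many of the
hyperplanes `L = 0`, `L ∈ 𝓛`. A meromorphic germ at `0` with poles along such hyperplanes is
a function taken modulo equality along this filter: `h / P` and `h' / P'` are identified
precisely if `h * P' = h' * P` near `0`. -/
noncomputable def poleFilter {k : ℕ} (𝓛 : Set (CnDual k)) : Filter (Cn k) :=
  𝓝 0 ⊓ ⨅ L ∈ 𝓛, 𝓟 {z | L z ≠ 0}

/-- The linear map sending a bounded holomorphic `h` on the ball of radius `1 / n` to the
meromorphic germ `h / P`. It identifies the Banach space `bHol Q n` isometrically with the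
Banach space of all fractions `h / P`, normed by `‖h / P‖ = ‖h‖`. -/
noncomputable def fracGerm {k : ℕ} (Q : InnerProductSpace.Core ℂ (Cn k)) (𝓛 : Set (CnDual k))
    (n : ℕ+) (P : Cn k → ℂ) : bHol Q n →ₗ[ℝ] Germ (poleFilter 𝓛) ℂ where
  toFun h := ((fun z => extendZero (h.1 : qBall Q n → ℂ) z / P z : Cn k → ℂ) :
    Germ (poleFilter 𝓛) ℂ)
  map_add' a b := by
    rw [← Germ.coe_add]
    congr 1
    funext z
    have := congrFun (extendZero_add (a.1 : qBall Q n → ℂ) (b.1 : qBall Q n → ℂ)) z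
    simp only [Submodule.coe_add, BoundedContinuousFunction.coe_add, this, Pi.add_apply, add_div]
  map_smul' c a := by
    rw [RingHom.id_apply, ← Germ.coe_smul]
    congr 1
    funext z
    have := congrFun (extendZero_smul c (a.1 : qBall Q n → ℂ)) z
    change extendZero (c • (a.1 : qBall Q n → ℂ)) z / P z = _
    rw [this]
    simp [mul_div_assoc]

/-- The real vector space of meromorphic germs at `0` with poles in `𝓛`: the union of the
directed system of the spaces of fractions `h / P`. -/
noncomputable def mero {k : ℕ} (Q : InnerProductSpace.Core ℂ (Cn k)) (𝓛 : Set (CnDual k)) :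
    Submodule ℝ (Germ (poleFilter 𝓛) ℂ) :=
  ⨆ (n : ℕ+) (P : poleSemigroup 𝓛), LinearMap.range (fracGerm Q 𝓛 n P)

theorem fracGerm_mem {k : ℕ} (Q : InnerProductSpace.Core ℂ (Cn k)) (𝓛 : Set (CnDual k))
    (n : ℕ+) (P : poleSemigroup 𝓛) (h : bHol Q n) : fracGerm Q 𝓛 n P h ∈ mero Q 𝓛 :=
  Submodule.mem_iSup_of_mem n (Submodule.mem_iSup_of_mem P ⟨h, rfl⟩)

/-- The canonical map of a step of the inductive system into the space of meromorphic germs. -/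
noncomputable def stepMap {k : ℕ} (Q : InnerProductSpace.Core ℂ (Cn k)) (𝓛 : Set (CnDual k))
    (n : ℕ+) (P : poleSemigroup 𝓛) : bHol Q n →ₗ[ℝ] mero Q 𝓛 :=
  (fracGerm Q 𝓛 n P).codRestrict (mero Q 𝓛) (fracGerm_mem Q 𝓛 n P)

/-- The locally convex inductive limit topology on the space of meromorphic germs: the finest
locally convex vector space topology for which the canonical map of every Banach step
is continuous. -/
@[reducible] noncomputable def meroTopology {k : ℕ} (Q : InnerProductSpace.Core ℂ (Cn k))
    (𝓛 : Set (CnDual k)) : TopologicalSpace (mero Q 𝓛) :=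
  sInf {t : TopologicalSpace (mero Q 𝓛) |
    @IsTopologicalAddGroup (mero Q 𝓛) t _ ∧ @ContinuousSMul ℝ (mero Q 𝓛) _ _ t ∧
    @LocallyConvexSpace ℝ (mero Q 𝓛) _ _ _ _ t ∧
    ∀ (n : ℕ+) (P : poleSemigroup 𝓛), @Continuous _ _ _ t (stepMap Q 𝓛 n P)}

/-- `f` is a meromorphic function of several variables on `U`: near every point of `U` it is a
quotient of two analytic functions, the denominator not being identically zero near the point.
The values of `f` at the zeros of the denominators are irrelevant. -/
def IsMeromorphic {k : ℕ} (f : Cn k → ℂ) (U : Set (Cn k)) : Prop :=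
  ∀ z ∈ U, ∃ p q : Cn k → ℂ, AnalyticAt ℂ p z ∧ AnalyticAt ℂ q z ∧ (∃ᶠ w in 𝓝 z, q w ≠ 0) ∧
    ∀ᶠ w in 𝓝 z, q w ≠ 0 → f w = p w / q w

/-- The meromorphic function `f` on `U` depends on the subspace `V` of the dual space: `V` is
spanned by linear forms `L₁, …, L_n`, and `f = g ∘ (L₁, …, L_n)` as meromorphic functions (that is,
on a dense open subset) on the nonempty set `U ∩ (L₁, …, L_n)⁻¹(W)`, where `g` is
a meromorphic function on an open connected set `W` in `ℂ^n`. -/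
def DependsOn {k : ℕ} (f : Cn k → ℂ) (U : Set (Cn k)) (V : Submodule ℂ (CnDual k)) : Prop :=
  ∃ (n : ℕ) (L : Fin n → CnDual k) (W : Set (Cn n)) (g : Cn n → ℂ),
    Submodule.span ℂ (Set.range L) = V ∧ IsOpen W ∧ IsConnected W ∧ IsMeromorphic g W ∧
    (U ∩ (fun z i => L i z) ⁻¹' W).Nonempty ∧
    U ∩ (fun z i => L i z) ⁻¹' W ⊆ closure (interior {z | f z = g (fun i => L i z)})

/-- The dependence subspace of a meromorphic germ at `0`: the smallest of all the subspaces of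
the dual space on which the germ depends, that is, on which a meromorphic function on
an open connected neighbourhood of `0` representing the germ depends. -/
noncomputable def dep {k : ℕ} {𝓛 : Set (CnDual k)} (φ : Germ (poleFilter 𝓛) ℂ) :
    Submodule ℂ (CnDual k) :=
  sInf {V | ∃ (U : Set (Cn k)) (f : Cn k → ℂ), IsOpen U ∧ IsConnected U ∧ 0 ∈ U ∧
    IsMeromorphic f U ∧ (f : Germ (poleFilter 𝓛) ℂ) = φ ∧ DependsOn f U V}

end LinearPoles

namespace LinearPoles

/-! ### Osgood's lemma via Cauchy's formula on polydiscs -/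

section Osgood

open Complex MeasureTheory Metric Real

/-! Call `v` invariant for a germ if the derivative of the germ in the direction `v` vanishes. The
invariant directions form exactly the annihilator of the dependence space
(`apply_eq_zero_of_mem_dep`, `mem_invariantDirections_of_forall_mem_dep`), so the theorem becomes a
semicontinuity statement about invariant directions. If it failed, the dependence spaces of all late
`f n` would stay at distance at least some `ε > 0` from `ℓ`. Hahn–Banach
(`exists_norm_le_one_of_dist_le`) would then give bounded vectors `v n`, annihilated by those spaces
and hence invariant for those germs, with `‖ℓ (v n)‖ ≥ ε`. A cluster point `u` is invariant for the
limit germ, so `ℓ u = 0`, a contradiction.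

Passing to the limit needs continuous maps that detect invariance. For `w` off all the hyperplanes,
a fraction `p / P` is analytic at `t • w` for small `t ≠ 0`, and the Laurent coefficients in `t` of
its differential at `t • w` are linear maps `coeff` on the space of germs. Cauchy's estimates make
them continuous on each Banach step, hence on the inductive limit (`tendsto_coeff`); a convergent
sequence need not be placed in a single step. Such `w` are dense by Baire's theorem, so these
coefficients determine whether the derivative vanishes. -/

theorem torusMap_mem_sphere_apply {k : ℕ} (c : Cn k) {R : ℝ} (hR : 0 < R) (θ : Fin k → ℝ)
    (i : Fin k) : dist (torusMap c (fun _ => R) θ i) (c i) = R := by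
  simp [torusMap, dist_eq_norm, Complex.norm_exp_ofReal_mul_I, abs_of_pos hR]

theorem torusMap_mem_closedBall {k : ℕ} (c : Cn k) {R : ℝ} (hR : 0 < R) (θ : Fin k → ℝ) :
    torusMap c (fun _ => R) θ ∈ closedBall c R :=
  mem_closedBall.2 <| (dist_pi_le_iff hR.le).2 fun i =>
    (torusMap_mem_sphere_apply c hR θ i).le

theorem torusMap_sub_ne_zero {k : ℕ} {c z : Cn k} {R : ℝ} (hR : 0 < R) (hz : z ∈ ball c R)
    (θ : Fin k → ℝ) (i : Fin k) : torusMap c (fun _ => R) θ i - z i ≠ 0 := fun h => by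
  have h1 := torusMap_mem_sphere_apply c hR θ i
  rw [sub_eq_zero.1 h] at h1
  exact absurd ((dist_pi_lt_iff hR).1 (mem_ball.1 hz) i) (by rw [h1]; exact lt_irrefl _)

theorem continuous_torusMap {k : ℕ} (c : Cn k) (R : Fin k → ℝ) : Continuous (torusMap c R) := by
  unfold torusMap
  fun_prop

theorem cauchyKernel_torusIntegrable {k : ℕ} {c z : Cn k} {R : ℝ} (hR : 0 < R)
    {f : Cn k → ℂ} (hf : ∀ x ∈ closedBall c R, DifferentiableAt ℂ f x) (hz : z ∈ ball c R) :
    TorusIntegrable (fun x => (∏ i, (x i - z i)⁻¹) * f x) c (fun _ => R) := by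
  refine Continuous.integrableOn_Icc ?_
  refine Continuous.mul (continuous_finsetProd _ fun i _ => Continuous.inv₀ ?_ ?_) ?_
  · exact Continuous.sub ((continuous_apply i).comp (continuous_torusMap c fun _ => R))
      (continuous_const (y := z i))
  · exact fun θ => torusMap_sub_ne_zero hR hz θ i
  · exact continuous_iff_continuousAt.2 fun θ =>
      ContinuousAt.comp (hf _ (torusMap_mem_closedBall c hR θ)).continuousAt
        (continuous_torusMap c _).continuousAt

/-- Cauchy's integral formula on a polydisc. -/
theorem torusIntegral_cauchyKernel {k : ℕ} {c z : Cn k} {R : ℝ} (hR : 0 < R)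
    {f : Cn k → ℂ} (hf : ∀ x ∈ closedBall c R, DifferentiableAt ℂ f x) (hz : z ∈ ball c R) :
    (∯ x in T(c, fun _ => R), (∏ i, (x i - z i)⁻¹) * f x) = (2 * π * I) ^ k * f z := by
  induction k with
  | zero => simp [torusIntegral_dim0, Subsingleton.elim z c]
  | succ k ih =>
    rw [torusIntegral_succ (cauchyKernel_torusIntegrable hR hf hz)]
    have hz' : ∀ i, dist (z i) (c i) < R := (dist_pi_lt_iff hR).1 (mem_ball.1 hz)
    have hcons : ∀ x ∈ closedBall (c 0) R, ∀ y ∈ closedBall (c ∘ Fin.succ) R,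
        (Fin.cons x y : Cn (k + 1)) ∈ closedBall c R := by
      intro x hx y hy
      refine mem_closedBall.2 ((dist_pi_le_iff hR.le).2 fun i => ?_)
      refine Fin.cases ?_ (fun j => ?_) i
      · simpa using hx
      · simpa using (dist_pi_le_iff hR.le).1 (mem_closedBall.1 hy) j
    have hzs : z ∘ Fin.succ ∈ ball (c ∘ Fin.succ) R :=
      mem_ball.2 ((dist_pi_lt_iff hR).2 fun j => hz' j.succ)
    -- With the first variable frozen on its circle, the inner integral is the induction hypothesis
    -- for the remaining variables.
    have key : ∀ x ∈ sphere (c 0) R,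
        (∯ y in T(c ∘ Fin.succ, (fun _ : Fin (k + 1) => R) ∘ Fin.succ),
          (∏ i, ((Fin.cons x y : Cn (k + 1)) i - z i)⁻¹) * f (Fin.cons x y)) =
        (2 * π * I) ^ k * ((x - z 0)⁻¹ • f (Fin.cons x (z ∘ Fin.succ))) := by
      intro x hx
      have hd : ∀ y ∈ closedBall (c ∘ Fin.succ) R,
          DifferentiableAt ℂ (fun y : Cn k => f (Fin.cons x y)) y := by
        intro y hy
        refine DifferentiableAt.comp (g := f) y (hf _ (hcons x (sphere_subset_closedBall hx) y hy)) ?_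
        refine differentiableAt_pi.2 fun i => ?_
        refine Fin.cases ?_ (fun j => ?_) i
        · simp
        · simpa using differentiableAt_apply j y
      have h2 := ih (c := c ∘ Fin.succ) (z := z ∘ Fin.succ) hd hzs
      simp only [Fin.prod_univ_succ, Fin.cons_zero, Fin.cons_succ, mul_assoc]
      rw [torusIntegral_const_mul]
      simp only [Function.comp_apply] at h2
      change (x - z 0)⁻¹ * (∯ y in T(c ∘ Fin.succ, fun _ => R), _) = _
      rw [h2, smul_eq_mul]
      ring_nf
    rw [circleIntegral.integral_congr hR.le key, circleIntegral.integral_const_mul]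
    have hd0 : DifferentiableOn ℂ (fun x : ℂ => f (Fin.cons x (z ∘ Fin.succ)))
        (closedBall (c 0) R) := by
      intro x hx
      refine DifferentiableAt.differentiableWithinAt ?_
      refine DifferentiableAt.comp (g := f) x (hf _ (hcons x hx _ (ball_subset_closedBall hzs))) ?_
      refine differentiableAt_pi.2 fun i => ?_
      refine Fin.cases ?_ (fun j => ?_) i
      · simp
      · simp
    rw [hd0.circleIntegral_sub_inv_smul (mem_ball.2 (hz' 0))]
    have : (Fin.cons (z 0) (z ∘ Fin.succ) : Cn (k + 1)) = z := Fin.cons_self_tail z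
    rw [this, smul_eq_mul, pow_succ]
    ring

/-- **Osgood's lemma**: a function of several complex variables which is complex differentiable
near a point is analytic there. -/
theorem analyticAt_of_eventually_differentiableAt {k : ℕ} {f : Cn k → ℂ} {c : Cn k}
    (hf : ∀ᶠ z in 𝓝 c, DifferentiableAt ℂ f z) : AnalyticAt ℂ f c := by
  obtain ⟨R, hR, hfR⟩ := Metric.nhds_basis_closedBall.eventually_iff.1 hf
  let Θ : Set (Fin k → ℝ) := Set.Icc 0 fun _ => 2 * π
  let T : Θ → Cn k := fun θ => torusMap c (fun _ => R) θ
  have hT : Continuous T := (continuous_torusMap c _).comp continuous_subtype_val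
  let Z : Fin k → C(Θ, ℂ) := fun i => ⟨fun θ => T θ i, (continuous_apply i).comp hT⟩
  -- The Cauchy kernel becomes an element of the Banach algebra of continuous functions on the
  -- parameter box. Inversion is analytic in a Banach algebra, so `K` is analytic in `z`, and
  -- integration against `J` (boundary values times the Jacobian factor of the torus) is a bounded
  -- functional.
  let K : Cn k → C(Θ, ℂ) := fun z => ∏ i, Ring.inverse (Z i - algebraMap ℂ _ (z i))
  let J : C(Θ, ℂ) := ⟨fun θ => (∏ i, (R : ℂ) * exp ((θ : Fin k → ℝ) i * I) * I) * f (T θ), by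
    refine Continuous.mul (continuous_finsetProd _ fun i _ => ?_) ?_
    · have : Continuous fun θ : Θ => (θ : Fin k → ℝ) i :=
        (continuous_apply i).comp continuous_subtype_val
      exact (continuous_const.mul (Complex.continuous_exp.comp
        ((Complex.continuous_ofReal.comp this).mul continuous_const))).mul continuous_const
    exact continuous_iff_continuousAt.2 fun θ =>
      ContinuousAt.comp (hfR (torusMap_mem_closedBall c hR θ)).continuousAt hT.continuousAt⟩
  let μ : Measure Θ := Measure.comap (Subtype.val) volume
  have hμ : μ Set.univ ≠ ⊤ := by
    have : μ Set.univ = volume Θ := by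
      rw [Measure.comap_apply _ Subtype.val_injective
        (fun s hs => (MeasurableEmbedding.subtype_coe measurableSet_Icc).measurableSet_image' hs)
        _ MeasurableSet.univ, Set.image_univ, Subtype.range_coe]
    rw [this]
    exact (measure_Icc_lt_top).ne
  have : IsFiniteMeasure μ := ⟨lt_top_iff_ne_top.2 hμ⟩
  have hint : ∀ g : C(Θ, ℂ), Integrable g μ := fun g =>
    g.continuous.integrable_of_hasCompactSupport (HasCompactSupport.of_compactSpace g)
  let L₀ : C(Θ, ℂ) →ₗ[ℂ] ℂ :=
    { toFun := fun g => ∫ θ, (g * J) θ ∂μ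
      map_add' := fun g h => by
        rw [← integral_add (hint _) (hint _)]
        simp [add_mul]
      map_smul' := fun a g => by
        rw [RingHom.id_apply, smul_eq_mul, ← integral_const_mul]
        simp [mul_assoc] }
  let L : C(Θ, ℂ) →L[ℂ] ℂ := L₀.mkContinuous (‖J‖ * μ.real Set.univ) fun g => by
    refine (norm_integral_le_of_norm_le_const (C := ‖g‖ * ‖J‖)
      (Eventually.of_forall fun θ => ((g * J).norm_coe_le_norm θ).trans (norm_mul_le _ _))).trans ?_
    exact le_of_eq (by ring)
  have hunit : ∀ z ∈ ball c R, ∀ i, IsUnit (Z i - algebraMap ℂ C(Θ, ℂ) (z i)) := fun z hz i =>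
    ContinuousMap.isUnit_iff_forall_ne_zero _ |>.2 fun θ => torusMap_sub_ne_zero hR hz θ i
  have hK : AnalyticAt ℂ K c := by
    refine Finset.analyticAt_fun_prod _ fun i _ => ?_
    obtain ⟨u, hu⟩ := hunit c (mem_ball_self hR) i
    have h1 : AnalyticAt ℂ (Ring.inverse : C(Θ, ℂ) → C(Θ, ℂ)) (Z i - algebraMap ℂ _ (c i)) :=
      hu ▸ analyticAt_inverse u
    refine AnalyticAt.fun_comp (f := fun z : Cn k => Z i - algebraMap ℂ C(Θ, ℂ) (z i)) h1 ?_
    refine analyticAt_const.sub ?_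
    exact ((Algebra.linearMap ℂ C(Θ, ℂ)).toContinuousLinearMap.comp
      (ContinuousLinearMap.proj (R := ℂ) (φ := fun _ : Fin k => ℂ) i)).analyticAt c
  have hrep : ∀ z ∈ ball c R, f z = ((2 * π * I) ^ k)⁻¹ * L (K z) := by
    intro z hz
    have h1 := torusIntegral_cauchyKernel hR (fun x hx => hfR hx) hz
    have h2 : L (K z) = (2 * π * I) ^ k * f z := by
      rw [← h1, torusIntegral]
      change ∫ θ : Θ, (K z * J) θ ∂μ = _
      rw [← integral_subtype_comap (measurableSet_Icc)]
      refine integral_congr_ae (Eventually.of_forall fun θ => ?_)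
      have h3 : ∀ i, Ring.inverse (Z i - algebraMap ℂ C(Θ, ℂ) (z i)) θ = (T θ i - z i)⁻¹ := by
        intro i
        have h4 := congrArg (fun g : C(Θ, ℂ) => g θ) (Ring.inverse_mul_cancel _ (hunit z hz i))
        exact eq_inv_of_mul_eq_one_left h4
      simp only [K, J, ContinuousMap.mul_apply, ContinuousMap.coe_mk, ContinuousMap.coe_prod,
        Finset.prod_apply, h3, smul_eq_mul, T]
      ring
    rw [h2, inv_mul_cancel_left₀ (pow_ne_zero _ (by simp [Real.pi_ne_zero]))]
  have h5 : AnalyticAt ℂ (fun z => ((2 * π * I) ^ k)⁻¹ * L (K z)) c :=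
    analyticAt_const.mul ((L.analyticAt _).fun_comp hK)
  exact h5.congr (eventually_of_mem (ball_mem_nhds c hR) fun z hz => (hrep z hz).symm)

end Osgood

end LinearPoles

/-! ### Balls, pole denominators and generic directions -/

namespace LinearPoles

/-- `Q` carries no link to the product topology, so continuity is read off from its expansion in the
standard basis as a polynomial in `z` and its conjugate. -/
theorem continuous_inner_self {k : ℕ} (Q : InnerProductSpace.Core ℂ (Cn k)) :
    Continuous fun z : Cn k => Q.inner z z := by
  have hr : ∀ x y : Cn k, Q.inner x y = ∑ j, y j * Q.inner x (Pi.single j 1) := by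
    intro x y
    let l : Cn k →ₗ[ℂ] ℂ :=
      { toFun := fun y => Q.inner x y
        map_add' := InnerProductSpace.Core.inner_add_right (c := Q.toCore) x
        map_smul' := fun r y => InnerProductSpace.Core.inner_smul_right (c := Q.toCore) x y }
    have h := l.pi_apply_eq_sum_univ y
    have hs : ∀ j : Fin k, (fun i => if j = i then (1 : ℂ) else 0) = Pi.single j 1 := fun j => by
      ext i
      simp [Pi.single_apply, eq_comm]
    simp only [hs] at h
    exact h
  have hl : ∀ x y : Cn k, Q.inner x y = starRingEnd ℂ (Q.inner y x) := fun x y =>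
    (Q.conj_inner_symm x y).symm
  have : (fun z : Cn k => Q.inner z z) = fun z =>
      ∑ j, z j * starRingEnd ℂ (∑ i, z i * Q.inner (Pi.single j 1) (Pi.single i 1)) := by
    funext z
    rw [hr z z]
    refine Finset.sum_congr rfl fun j _ => ?_
    rw [hl z, hr _ z]
  rw [this]
  refine continuous_finsetSum _ fun j _ => (continuous_apply j).mul
    (Complex.continuous_conj.comp (continuous_finsetSum _ fun i _ =>
      (continuous_apply i).mul continuous_const))

theorem isOpen_qBall {k : ℕ} (Q : InnerProductSpace.Core ℂ (Cn k)) (n : ℕ+) :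
    IsOpen (qBall Q n) :=
  isOpen_lt (Real.continuous_sqrt.comp (Complex.continuous_re.comp (continuous_inner_self Q)))
    continuous_const

theorem zero_mem_qBall {k : ℕ} (Q : InnerProductSpace.Core ℂ (Cn k)) (n : ℕ+) :
    (0 : Cn k) ∈ qBall Q n := by
  have h : Q.inner (0 : Cn k) 0 = 0 := InnerProductSpace.Core.inner_zero_left (c := Q.toCore) 0
  simp [qBall, h]

theorem qBall_mem_nhds_zero {k : ℕ} (Q : InnerProductSpace.Core ℂ (Cn k)) (n : ℕ+) :
    qBall Q n ∈ 𝓝 (0 : Cn k) :=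
  (isOpen_qBall Q n).mem_nhds (zero_mem_qBall Q n)

theorem analyticAt_extendZero {k : ℕ} {Q : InnerProductSpace.Core ℂ (Cn k)} {n : ℕ+}
    (h : bHol Q n) {z : Cn k} (hz : z ∈ qBall Q n) :
    AnalyticAt ℂ (extendZero (h.1 : qBall Q n → ℂ)) z :=
  analyticAt_of_eventually_differentiableAt <|
    eventually_of_mem ((isOpen_qBall Q n).mem_nhds hz) fun _ hy =>
      h.2.1.differentiableAt ((isOpen_qBall Q n).mem_nhds hy)

theorem norm_extendZero_le {k : ℕ} {Q : InnerProductSpace.Core ℂ (Cn k)} {n : ℕ+}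
    (h : bHol Q n) (z : Cn k) : ‖extendZero (h.1 : qBall Q n → ℂ) z‖ ≤ ‖h‖ := by
  unfold extendZero
  split_ifs with hz
  · exact h.1.norm_coe_le_norm ⟨z, hz⟩
  · rw [norm_zero]
    exact norm_nonneg h

/-- The monoid of all products, including the empty one, of members of `𝓛`. -/
def poleMonoid {k : ℕ} (𝓛 : Set (CnDual k)) : Submonoid (Cn k → ℂ) :=
  Submonoid.closure ((fun L : CnDual k => (L : Cn k → ℂ)) '' 𝓛)

theorem mem_poleMonoid_of_mem_poleSemigroup {k : ℕ} {𝓛 : Set (CnDual k)} {P : Cn k → ℂ}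
    (hP : P ∈ poleSemigroup 𝓛) : P ∈ poleMonoid 𝓛 :=
  (Subsemigroup.closure_le (S := (poleMonoid 𝓛).toSubsemigroup)).2 Submonoid.subset_closure hP

theorem analyticAt_of_mem_poleMonoid {k : ℕ} {𝓛 : Set (CnDual k)} {P : Cn k → ℂ}
    (hP : P ∈ poleMonoid 𝓛) (z : Cn k) : AnalyticAt ℂ P z := by
  induction hP using Submonoid.closure_induction with
  | mem x hx =>
    obtain ⟨L, -, rfl⟩ := hx
    exact L.analyticAt z
  | one => exact analyticAt_const
  | mul x y _ _ hx hy => exact hx.mul hy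

/-- Homogeneity confines the zeros of `P` on a generic complex line through `0` to the origin. -/
theorem homogeneous_of_mem_poleMonoid {k : ℕ} {𝓛 : Set (CnDual k)} {P : Cn k → ℂ}
    (hP : P ∈ poleMonoid 𝓛) : ∃ r : ℕ, ∀ (t : ℂ) (z : Cn k), P (t • z) = t ^ r * P z := by
  induction hP using Submonoid.closure_induction with
  | mem x hx =>
    obtain ⟨L, -, rfl⟩ := hx
    exact ⟨1, fun t z => by simp⟩
  | one => exact ⟨0, fun t z => by simp⟩
  | mul x y _ _ hx hy =>
    obtain ⟨r, hr⟩ := hx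
    obtain ⟨s, hs⟩ := hy
    exact ⟨r + s, fun t z => by simp only [Pi.mul_apply, hr, hs]; ring⟩

theorem ne_zero_of_mem_poleMonoid {k : ℕ} {𝓛 : Set (CnDual k)} {P : Cn k → ℂ}
    (hP : P ∈ poleMonoid 𝓛) {w : Cn k} (hw : ∀ L ∈ 𝓛, L w ≠ 0) : P w ≠ 0 := by
  induction hP using Submonoid.closure_induction with
  | mem x hx =>
    obtain ⟨L, hL, rfl⟩ := hx
    exact hw L hL
  | one => simp
  | mul x y _ _ hx hy => exact mul_ne_zero hx hy

theorem eventually_ne_zero_of_mem_poleMonoid {k : ℕ} {𝓛 : Set (CnDual k)} {P : Cn k → ℂ}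
    (hP : P ∈ poleMonoid 𝓛) : ∀ᶠ z in poleFilter 𝓛, P z ≠ 0 := by
  induction hP using Submonoid.closure_induction with
  | mem x hx =>
    obtain ⟨L, hL, rfl⟩ := hx
    exact mem_inf_of_right (mem_iInf_of_mem L (mem_iInf_of_mem hL (mem_principal_self _)))
  | one => simp
  | mul x y _ _ hx hy =>
    filter_upwards [hx, hy] with z h1 h2 using mul_ne_zero h1 h2

/-- Almost every point, in the sense of Baire, lies off all the hyperplanes. -/
theorem dense_setOf_forall_ne_zero {k : ℕ} {𝓛 : Set (CnDual k)} (h𝓛 : IsGeneratingSet 𝓛) :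
    Dense {w : Cn k | ∀ L ∈ 𝓛, L w ≠ 0} := by
  have h : {w : Cn k | ∀ L ∈ 𝓛, L w ≠ 0} = ⋂ L ∈ 𝓛, {w : Cn k | L w ≠ 0} := by
    ext w; simp
  rw [h]
  refine dense_biInter_of_isOpen (fun L _ => isOpen_ne_fun L.continuous continuous_const)
    h𝓛.countable fun L hL => ?_
  have h0 : interior ((LinearMap.ker (L : Cn k →ₗ[ℂ] ℂ) : Submodule ℂ (Cn k)) : Set (Cn k)) = ∅ := by
    by_contra hne
    have := Submodule.eq_top_of_nonempty_interior' _ (Set.nonempty_iff_ne_empty.2 hne)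
    refine h𝓛.zero_notMem ?_
    convert hL
    ext z
    exact (LinearMap.mem_ker.1 (this ▸ Submodule.mem_top : z ∈ LinearMap.ker (L : Cn k →ₗ[ℂ] ℂ))).symm
  exact interior_eq_empty_iff_dense_compl.1 h0

/-- A property of meromorphic germs holds near all the points `t • w`, for small `t ≠ 0`,
if `w` lies off all the hyperplanes. -/
theorem eventually_eventually_smul {k : ℕ} {𝓛 : Set (CnDual k)} {w : Cn k}
    (hw : ∀ L ∈ 𝓛, L w ≠ 0) {A : Cn k → Prop} (hA : ∀ᶠ z in poleFilter 𝓛, A z) :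
    ∀ᶠ t in 𝓝[≠] (0 : ℂ), ∀ᶠ z in 𝓝 (t • w), A z := by
  -- The bound filter consists of the sets that are neighbourhoods of `t • w` for all small `t ≠ 0`;
  -- the claim is that every basic set of `poleFilter 𝓛` is of this kind.
  have hle : (𝓝[≠] (0 : ℂ)).bind (fun t => 𝓝 (t • w)) ≤ poleFilter 𝓛 := by
    refine le_inf (fun s hs => ?_) (le_iInf₂ fun L hL => le_principal_iff.2 ?_)
    · have h1 : Tendsto (fun t : ℂ => t • w) (𝓝[≠] 0) (𝓝 0) :=
        tendsto_nhdsWithin_of_tendsto_nhds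
          (Continuous.tendsto' (by fun_prop) _ _ (zero_smul ℂ w))
      exact eventually_bind.2 (h1.eventually (eventually_eventually_nhds.2 hs))
    · refine eventually_bind.2 ?_
      filter_upwards [self_mem_nhdsWithin] with t ht
      refine (isOpen_ne_fun L.continuous continuous_const).mem_nhds ?_
      have : t ≠ 0 := ht
      simp [this, hw L hL]
  exact eventually_bind.1 (hle hA)

/-- Common denominators make the fractions a real subspace, which therefore contains the supremum of
all the steps. -/
theorem exists_eq_div_of_mem_mero {k : ℕ} {Q : InnerProductSpace.Core ℂ (Cn k)}
    {𝓛 : Set (CnDual k)} {φ : Germ (poleFilter 𝓛) ℂ} (hφ : φ ∈ mero Q 𝓛) :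
    ∃ p P : Cn k → ℂ, AnalyticAt ℂ p 0 ∧ P ∈ poleMonoid 𝓛 ∧
      φ = ((fun z => p z / P z : Cn k → ℂ) : Germ (poleFilter 𝓛) ℂ) := by
  let M : Submodule ℝ (Germ (poleFilter 𝓛) ℂ) :=
    { carrier := {φ | ∃ p P : Cn k → ℂ, AnalyticAt ℂ p 0 ∧ P ∈ poleMonoid 𝓛 ∧
        φ = ((fun z => p z / P z : Cn k → ℂ) : Germ (poleFilter 𝓛) ℂ)}
      add_mem' := by
        rintro _ _ ⟨p, P, hp, hP, rfl⟩ ⟨q, R, hq, hR, rfl⟩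
        refine ⟨fun z => p z * R z + q z * P z, fun z => P z * R z,
          (hp.mul (analyticAt_of_mem_poleMonoid hR 0)).add
            (hq.mul (analyticAt_of_mem_poleMonoid hP 0)), mul_mem hP hR, ?_⟩
        rw [← Germ.coe_add]
        refine Germ.coe_eq.2 ?_
        filter_upwards [eventually_ne_zero_of_mem_poleMonoid hP,
          eventually_ne_zero_of_mem_poleMonoid hR] with z h1 h2
        simp only [Pi.add_apply]
        field_simp
      -- The empty product is needed here: for empty `𝓛` the semigroup offers no denominator at all.
      zero_mem' := ⟨0, 1, analyticAt_const, one_mem _, Germ.coe_eq.2 (by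
        filter_upwards with z
        simp)⟩
      smul_mem' := by
        rintro c _ ⟨p, P, hp, hP, rfl⟩
        refine ⟨fun z => (c : ℂ) * p z, P, analyticAt_const.mul hp, hP, ?_⟩
        rw [← Germ.coe_smul]
        refine Germ.coe_eq.2 ?_
        filter_upwards with z
        simp [mul_div_assoc] }
  have hle : mero Q 𝓛 ≤ M := by
    refine iSup₂_le fun n P => ?_
    rintro _ ⟨h, rfl⟩
    exact ⟨_, P, analyticAt_extendZero h (zero_mem_qBall Q n),
      mem_poleMonoid_of_mem_poleSemigroup P.2, rfl⟩
  exact hle hφ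

end LinearPoles

/-! ### Laurent coefficients of the differential along generic lines, and their continuity -/

namespace LinearPoles

open Metric

/-- `c` is the Laurent coefficient of order `-N - 1`, up to the factor `2πi`, of the differential of
the germ `φ` along the complex line through `w`. -/
def HasCoeff {k : ℕ} {𝓛 : Set (CnDual k)} (N : ℤ) (w : Cn k) (φ : Germ (poleFilter 𝓛) ℂ)
    (c : CnDual k) : Prop :=
  ∃ f : Cn k → ℂ, (f : Germ (poleFilter 𝓛) ℂ) = φ ∧ ∀ᶠ ε in 𝓝[>] (0 : ℝ),
    (∀ t ∈ sphere (0 : ℂ) ε, DifferentiableAt ℂ f (t • w)) ∧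
    CircleIntegrable (fun t => t ^ N • fderiv ℂ f (t • w)) 0 ε ∧
    (∮ t in C(0, ε), t ^ N • fderiv ℂ f (t • w)) = c

theorem eventually_forall_mem_sphere {A : ℂ → Prop} (hA : ∀ᶠ t in 𝓝[≠] (0 : ℂ), A t) :
    ∀ᶠ ε in 𝓝[>] (0 : ℝ), ∀ t ∈ sphere (0 : ℂ) ε, A t := by
  obtain ⟨R, hR, h⟩ := Metric.eventually_nhds_iff.1 (eventually_nhdsWithin_iff.1 hA)
  filter_upwards [Ioo_mem_nhdsGT hR] with ε hε t ht
  have ht' : dist t 0 = ε := ht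
  refine h (ht'.trans_lt hε.2) fun h0 => ?_
  rw [Set.mem_singleton_iff.1 h0, dist_self] at ht'
  exact hε.1.ne ht'

/-- Two representatives agree near each `t • w` with `t ≠ 0` small, so they have the same
differential on every small circle; demanding the integral identity for all small radii guarantees a
common one. -/
theorem HasCoeff.unique {k : ℕ} {𝓛 : Set (CnDual k)} {N : ℤ} {w : Cn k}
    (hw : ∀ L ∈ 𝓛, L w ≠ 0) {φ : Germ (poleFilter 𝓛) ℂ} {c c' : CnDual k}
    (h : HasCoeff N w φ c) (h' : HasCoeff N w φ c') : c = c' := by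
  obtain ⟨f, hf, hfc⟩ := h
  obtain ⟨g, hg, hgc⟩ := h'
  have hfg : f =ᶠ[poleFilter 𝓛] g := Germ.coe_eq.1 (hf.trans hg.symm)
  obtain ⟨ε, ⟨-, -, h1⟩, ⟨-, -, h2⟩, h3, h4⟩ := (hfc.and (hgc.and
    ((eventually_forall_mem_sphere (eventually_eventually_smul hw hfg)).and
      self_mem_nhdsWithin))).exists
  rw [← h1, ← h2]
  refine circleIntegral.integral_congr (le_of_lt h4) fun t ht => ?_
  have : f =ᶠ[𝓝 (t • w)] g := h3 t ht
  simp only [this.fderiv_eq]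

theorem HasCoeff.add {k : ℕ} {𝓛 : Set (CnDual k)} {N : ℤ} {w : Cn k}
    {φ ψ : Germ (poleFilter 𝓛) ℂ} {c d : CnDual k}
    (h : HasCoeff N w φ c) (h' : HasCoeff N w ψ d) : HasCoeff N w (φ + ψ) (c + d) := by
  obtain ⟨f, rfl, hfc⟩ := h
  obtain ⟨g, rfl, hgc⟩ := h'
  refine ⟨f + g, Germ.coe_add f g, ?_⟩
  filter_upwards [hfc, hgc, self_mem_nhdsWithin] with ε ⟨h1, h2, h3⟩ ⟨h4, h5, h6⟩ hε
  have he : Set.EqOn (fun t : ℂ => t ^ N • fderiv ℂ (f + g) (t • w))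
      (fun t => t ^ N • fderiv ℂ f (t • w) + t ^ N • fderiv ℂ g (t • w)) (sphere 0 ε) := by
    intro t ht
    simp only [fderiv_add (h1 t ht) (h4 t ht), smul_add]
  refine ⟨fun t ht => (h1 t ht).add (h4 t ht), ?_, ?_⟩
  · have h0 : (0 : ℝ) ≤ ε := le_of_lt hε
    refine (circleIntegrable_congr ?_).2 (h2.add h5)
    rwa [abs_of_nonneg h0]
  · rw [circleIntegral.integral_congr (le_of_lt hε) he, circleIntegral.integral_add h2 h5, h3, h6]

theorem HasCoeff.smul {k : ℕ} {𝓛 : Set (CnDual k)} {N : ℤ} {w : Cn k}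
    {φ : Germ (poleFilter 𝓛) ℂ} {c : CnDual k} (a : ℝ)
    (h : HasCoeff N w φ c) : HasCoeff N w (a • φ) (a • c) := by
  obtain ⟨f, rfl, hfc⟩ := h
  refine ⟨a • f, Germ.coe_smul a f, ?_⟩
  filter_upwards [hfc, self_mem_nhdsWithin] with ε ⟨h1, h2, h3⟩ hε
  have he : Set.EqOn (fun t : ℂ => t ^ N • fderiv ℂ (a • f) (t • w))
      (fun t => (a : ℂ) • (t ^ N • fderiv ℂ f (t • w))) (sphere 0 ε) := by
    intro t ht
    have : a • f = (a : ℂ) • f := by ext; simp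
    simp only [this, fderiv_const_smul (h1 t ht), smul_comm (t ^ N)]
  have h4 : CircleIntegrable (fun t : ℂ => (a : ℂ) • (t ^ N • fderiv ℂ f (t • w))) 0 ε :=
    IntervalIntegrable.smul h2 (a : ℂ)
  refine ⟨fun t ht => (h1 t ht).const_smul a, ?_, ?_⟩
  · refine (circleIntegrable_congr ?_).2 h4
    rwa [abs_of_nonneg (le_of_lt hε)]
  · rw [circleIntegral.integral_congr (le_of_lt hε) he, circleIntegral.integral_smul, h3]
    ext
    simp

/-- The integrals defining the Laurent coefficients do not depend on the radius. -/
theorem hasCoeff_coe {k : ℕ} {𝓛 : Set (CnDual k)} (N : ℤ) {w : Cn k} {f : Cn k → ℂ} {R : ℝ}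
    (hf : ∀ t : ℂ, t ≠ 0 → ‖t‖ < R → AnalyticAt ℂ f (t • w)) {ε : ℝ} (hε : ε ∈ Set.Ioo 0 R) :
    HasCoeff N w (f : Germ (poleFilter 𝓛) ℂ) (∮ t in C(0, ε), t ^ N • fderiv ℂ f (t • w)) := by
  have hd : ∀ t : ℂ, t ≠ 0 → ‖t‖ < R →
      DifferentiableAt ℂ (fun t : ℂ => t ^ N • fderiv ℂ f (t • w)) t := by
    intro t ht htR
    refine (differentiableAt_zpow.2 (Or.inl ht)).smul ?_
    exact (hf t ht htR).fderiv.differentiableAt.comp t (by fun_prop)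
  refine ⟨f, rfl, ?_⟩
  filter_upwards [Ioo_mem_nhdsGT hε.1] with δ hδ
  have hs : ∀ t ∈ sphere (0 : ℂ) δ, t ≠ 0 ∧ ‖t‖ < R := by
    intro t ht
    rw [mem_sphere_zero_iff_norm] at ht
    exact ⟨norm_ne_zero_iff.1 (ht ▸ hδ.1.ne'), ht ▸ hδ.2.trans hε.2⟩
  refine ⟨fun t ht => (hf t (hs t ht).1 (hs t ht).2).differentiableAt, ?_, ?_⟩
  · exact ContinuousOn.circleIntegrable hδ.1.le fun t ht =>
      (hd t (hs t ht).1 (hs t ht).2).continuousAt.continuousWithinAt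
  -- Cauchy's theorem on the closed annulus between the radii `δ` and `ε`.
  · refine (Complex.circleIntegral_eq_of_differentiable_on_annulus_off_countable hδ.1 hδ.2.le
      Set.countable_empty (fun t ht => ?_) fun t ht => ?_).symm
    · have h1 : ‖t‖ ≤ ε := by simpa using ht.1
      have h2 : δ ≤ ‖t‖ := by simpa using ht.2
      exact (hd t (norm_pos_iff.1 (hδ.1.trans_le h2))
        (h1.trans_lt hε.2)).continuousAt.continuousWithinAt
    · have h1 : ‖t‖ < ε := by simpa using ht.1.1
      have h2 : δ < ‖t‖ := by simpa using ht.1.2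
      exact hd t (norm_pos_iff.1 (hδ.1.trans h2)) (h1.trans hε.2)

/-- A quotient of an analytic function by a product of linear forms is analytic at all small nonzero
multiples of a generic point. -/
theorem exists_analyticAt_div_smul {k : ℕ} {𝓛 : Set (CnDual k)} {w : Cn k}
    (hw : ∀ L ∈ 𝓛, L w ≠ 0) {p P : Cn k → ℂ} (hp : AnalyticAt ℂ p 0) (hP : P ∈ poleMonoid 𝓛) :
    ∃ R > 0, ∀ t : ℂ, t ≠ 0 → ‖t‖ < R → AnalyticAt ℂ (fun z => p z / P z) (t • w) := by
  have h1 : Tendsto (fun t : ℂ => t • w) (𝓝 0) (𝓝 0) :=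
    Continuous.tendsto' (by fun_prop) _ _ (zero_smul ℂ w)
  obtain ⟨R, hR, h⟩ := Metric.eventually_nhds_iff.1 (h1.eventually hp.eventually_analyticAt)
  refine ⟨R, hR, fun t ht htR => (h (by simpa using htR)).div (analyticAt_of_mem_poleMonoid hP _) ?_⟩
  obtain ⟨r, hr⟩ := homogeneous_of_mem_poleMonoid hP
  rw [hr]
  exact mul_ne_zero (pow_ne_zero _ ht) (ne_zero_of_mem_poleMonoid hP hw)

theorem exists_hasCoeff {k : ℕ} {Q : InnerProductSpace.Core ℂ (Cn k)}
    {𝓛 : Set (CnDual k)} (N : ℤ) {w : Cn k} (hw : ∀ L ∈ 𝓛, L w ≠ 0) (φ : mero Q 𝓛) :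
    ∃ c, HasCoeff N w φ.1 c := by
  obtain ⟨p, P, hp, hP, h⟩ := exists_eq_div_of_mem_mero φ.2
  obtain ⟨R, hR, hf⟩ := exists_analyticAt_div_smul hw hp hP
  rw [h]
  exact ⟨_, hasCoeff_coe N hf (ε := R / 2) ⟨half_pos hR, half_lt_self hR⟩⟩

/-- The Laurent coefficients of the differential of a germ along the complex line through a generic
point, as linear maps on the space of all germs. -/
noncomputable def coeff {k : ℕ} (Q : InnerProductSpace.Core ℂ (Cn k))
    {𝓛 : Set (CnDual k)} (N : ℤ) {w : Cn k} (hw : ∀ L ∈ 𝓛, L w ≠ 0) :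
    mero Q 𝓛 →ₗ[ℝ] CnDual k where
  toFun φ := (exists_hasCoeff N hw φ).choose
  map_add' φ ψ := (exists_hasCoeff N hw (φ + ψ)).choose_spec.unique hw
    ((exists_hasCoeff N hw φ).choose_spec.add (exists_hasCoeff N hw ψ).choose_spec)
  map_smul' a φ := (exists_hasCoeff N hw (a • φ)).choose_spec.unique hw
    ((exists_hasCoeff N hw φ).choose_spec.smul a)

theorem HasCoeff.coeff_eq {k : ℕ} {Q : InnerProductSpace.Core ℂ (Cn k)}
    {𝓛 : Set (CnDual k)} {N : ℤ} {w : Cn k} {φ : mero Q 𝓛} {c : CnDual k}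
    (h : HasCoeff N w φ.1 c) (hw : ∀ L ∈ 𝓛, L w ≠ 0) : coeff Q N hw φ = c :=
  (exists_hasCoeff N hw φ).choose_spec.unique hw h

theorem coeff_eq_circleIntegral {k : ℕ} {Q : InnerProductSpace.Core ℂ (Cn k)}
    {𝓛 : Set (CnDual k)} (N : ℤ) {w : Cn k} (hw : ∀ L ∈ 𝓛, L w ≠ 0) {φ : mero Q 𝓛}
    {f : Cn k → ℂ} (hfφ : φ.1 = (f : Germ (poleFilter 𝓛) ℂ)) {R : ℝ}
    (hf : ∀ t : ℂ, t ≠ 0 → ‖t‖ < R → AnalyticAt ℂ f (t • w)) {ε : ℝ} (hε : ε ∈ Set.Ioo 0 R) :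
    coeff Q N hw φ = ∮ t in C(0, ε), t ^ N • fderiv ℂ f (t • w) :=
  HasCoeff.coeff_eq (hfφ ▸ hasCoeff_coe N hf hε) hw

theorem coeff_apply_eq_circleIntegral {k : ℕ} {Q : InnerProductSpace.Core ℂ (Cn k)}
    {𝓛 : Set (CnDual k)} (N : ℤ) {w : Cn k} (hw : ∀ L ∈ 𝓛, L w ≠ 0) {φ : mero Q 𝓛}
    {f : Cn k → ℂ} (hfφ : φ.1 = (f : Germ (poleFilter 𝓛) ℂ)) {R : ℝ}
    (hf : ∀ t : ℂ, t ≠ 0 → ‖t‖ < R → AnalyticAt ℂ f (t • w)) {ε : ℝ} (hε : ε ∈ Set.Ioo 0 R)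
    (v : Cn k) :
    coeff Q N hw φ v = ∮ t in C(0, ε), t ^ N * fderiv ℂ f (t • w) v := by
  rw [coeff_eq_circleIntegral N hw hfφ hf hε, circleIntegral, circleIntegral]
  have hc : CircleIntegrable (fun t => t ^ N • fderiv ℂ f (t • w)) 0 ε := by
    refine ContinuousOn.circleIntegrable hε.1.le fun t ht => ContinuousAt.continuousWithinAt ?_
    rw [mem_sphere_zero_iff_norm] at ht
    have ht0 : t ≠ 0 := norm_ne_zero_iff.1 (ht ▸ hε.1.ne')
    refine (continuousAt_zpow₀ t N (Or.inl ht0)).smul ?_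
    exact ContinuousAt.comp (hf t ht0 (ht ▸ hε.2)).fderiv.continuousAt (by fun_prop)
  have := ((ContinuousLinearMap.apply ℂ ℂ v).intervalIntegral_comp_comm hc.out).symm
  simpa using this

/-- Cauchy's estimate for the differential, uniformly on a compact set. -/
theorem exists_norm_fderiv_le {k : ℕ} {K O : Set (Cn k)} (hK : IsCompact K) (hO : IsOpen O)
    (hKO : K ⊆ O) : ∃ C : ℝ, 0 ≤ C ∧ ∀ (F : Cn k → ℂ) (M : ℝ), (∀ z ∈ O, DifferentiableAt ℂ F z) →
      (∀ z ∈ O, ‖F z‖ ≤ M) → ∀ z ∈ K, ‖fderiv ℂ F z‖ ≤ C * M := by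
  obtain ⟨δ, hδ, hδO⟩ := hK.exists_cthickening_subset_open hO hKO
  refine ⟨1 / δ, by positivity, fun F M hF hM z hz => ?_⟩
  have hM0 : 0 ≤ M := (norm_nonneg _).trans (hM z (hKO hz))
  -- Restricting to the complex line in a unit direction `u` reduces the claim to the one-variable
  -- Cauchy estimate on a disc of radius `δ`.
  refine ContinuousLinearMap.opNorm_le_of_unit_norm (by positivity) fun u hu => ?_
  have hmem : ∀ s ∈ closedBall (0 : ℂ) δ, z + s • u ∈ O := by
    intro s hs
    refine hδO (mem_cthickening_of_dist_le _ z _ _ hz ?_)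
    rw [mem_closedBall_zero_iff] at hs
    simpa [norm_smul, hu] using hs
  have hl : ∀ s : ℂ, HasDerivAt (fun s : ℂ => z + s • u) u s := fun s => by
    simpa using ((hasDerivAt_id s).smul_const u).const_add z
  have hd : ∀ s ∈ closedBall (0 : ℂ) δ,
      HasDerivAt (fun s : ℂ => F (z + s • u)) (fderiv ℂ F (z + s • u) u) s := fun s hs =>
    (hF _ (hmem s hs)).hasFDerivAt.comp_hasDerivAt s (hl s)
  have h1 := Complex.norm_deriv_le_of_forall_mem_sphere_norm_le hδ (c := 0) (C := M)
    (f := fun s : ℂ => F (z + s • u))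
    (DifferentiableOn.diffContOnCl fun s hs => (hd s
      (closure_ball_subset_closedBall hs)).differentiableAt.differentiableWithinAt)
    fun s hs => hM _ (hmem s (sphere_subset_closedBall hs))
  rw [(hd 0 (mem_closedBall_self hδ.le)).deriv] at h1
  simpa [div_eq_inv_mul] using h1

/-- The circle of integration is a compact set free of zeros of `P`, so `1 / P` is bounded near it.
Hence `h / P` is bounded there by a multiple of `‖h‖`, and Cauchy's estimate carries this over to
the differential. -/
theorem continuous_coeff_comp_stepMap {k : ℕ} (Q : InnerProductSpace.Core ℂ (Cn k))
    {𝓛 : Set (CnDual k)} (N : ℤ) {w : Cn k} (hw : ∀ L ∈ 𝓛, L w ≠ 0) (n : ℕ+)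
    (P : poleSemigroup 𝓛) : Continuous fun h => coeff Q N hw (stepMap Q 𝓛 n P h) := by
  have hP := mem_poleMonoid_of_mem_poleSemigroup P.2
  have hPc : Continuous P.1 :=
    continuous_iff_continuousAt.2 fun z => (analyticAt_of_mem_poleMonoid hP z).continuousAt
  have h1 : Tendsto (fun t : ℂ => t • w) (𝓝 0) (𝓝 0) :=
    Continuous.tendsto' (by fun_prop) _ _ (zero_smul ℂ w)
  obtain ⟨R, hR, hRb⟩ := Metric.eventually_nhds_iff.1
    (h1.eventually (qBall_mem_nhds_zero Q n))
  have hPne : ∀ t : ℂ, t ≠ 0 → P.1 (t • w) ≠ 0 := fun t ht => by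
    obtain ⟨r, hr⟩ := homogeneous_of_mem_poleMonoid hP
    rw [hr]
    exact mul_ne_zero (pow_ne_zero _ ht) (ne_zero_of_mem_poleMonoid hP hw)
  have hRb' : ∀ t : ℂ, ‖t‖ < R → t • w ∈ qBall Q n := fun t ht => hRb (by simpa using ht)
  have hε : R / 2 ∈ Set.Ioo 0 R := ⟨half_pos hR, half_lt_self hR⟩
  let K : Set (Cn k) := (fun t : ℂ => t • w) '' sphere 0 (R / 2)
  have hK : IsCompact K := (isCompact_sphere _ _).image (by fun_prop)
  have hs : ∀ t ∈ sphere (0 : ℂ) (R / 2), t ≠ 0 ∧ ‖t‖ < R := fun t ht => by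
    rw [mem_sphere_zero_iff_norm] at ht
    exact ⟨norm_ne_zero_iff.1 (ht ▸ hε.1.ne'), ht ▸ hε.2⟩
  have hKP : ∀ z ∈ K, P.1 z ≠ 0 := by
    rintro _ ⟨t, ht, rfl⟩
    exact hPne t (hs t ht).1
  obtain ⟨B, hB⟩ := hK.exists_bound_of_continuousOn
    (f := fun z => (P.1 z)⁻¹) (hPc.continuousOn.inv₀ hKP)
  -- Enlarging the bound `B`, valid on `K`, to `B + 1` makes the inequality strict, so that it
  -- defines an open neighbourhood of `K`.
  let O : Set (Cn k) := qBall Q n ∩ ({z | P.1 z ≠ 0} ∩ {z | 1 < (B + 1) * ‖P.1 z‖})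
  have hO : IsOpen O := (isOpen_qBall Q n).inter ((isOpen_ne_fun hPc continuous_const).inter
    (isOpen_lt continuous_const (continuous_const.mul hPc.norm)))
  have hKO : K ⊆ O := by
    rintro _ ⟨t, ht, rfl⟩
    have h2 := hKP _ ⟨t, ht, rfl⟩
    refine ⟨hRb' t (hs t ht).2, h2, ?_⟩
    have h3 := hB _ ⟨t, ht, rfl⟩
    have h4 : 0 < ‖P.1 (t • w)‖ := norm_pos_iff.2 h2
    rw [norm_inv, inv_le_iff_one_le_mul₀ h4] at h3
    change 1 < (B + 1) * ‖P.1 (t • w)‖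
    nlinarith
  obtain ⟨C, hC0, hC⟩ := exists_norm_fderiv_le hK hO hKO
  refine AddMonoidHomClass.continuous_of_bound ((coeff Q N hw).comp (stepMap Q 𝓛 n P))
    (2 * Real.pi * (R / 2) * ((R / 2) ^ N * (C * (B + 1)))) fun h => ?_
  have hf : ∀ t : ℂ, t ≠ 0 → ‖t‖ < R →
      AnalyticAt ℂ (fun z => extendZero (h.1 : qBall Q n → ℂ) z / P.1 z) (t • w) := fun t ht htR =>
    (analyticAt_extendZero h (hRb' t htR)).div (analyticAt_of_mem_poleMonoid hP _) (hPne t ht)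
  have h5 := coeff_eq_circleIntegral N hw (φ := stepMap Q 𝓛 n P h) rfl hf hε
  rw [LinearMap.comp_apply, h5, mul_assoc _ _ ‖h‖]
  refine circleIntegral.norm_integral_le_of_norm_le_const hε.1.le fun t ht => ?_
  have h6 := hC (fun z => extendZero (h.1 : qBall Q n → ℂ) z / P.1 z) ((B + 1) * ‖h‖)
    (fun z hz => ((analyticAt_extendZero h hz.1).div
      (analyticAt_of_mem_poleMonoid hP _) hz.2.1).differentiableAt) (fun z hz => by
        have h7 : 0 < ‖P.1 z‖ := norm_pos_iff.2 hz.2.1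
        have h8 : 1 < (B + 1) * ‖P.1 z‖ := hz.2.2
        rw [norm_div, div_le_iff₀ h7]
        have h9 := norm_extendZero_le h z
        have h10 : 0 ≤ ‖h‖ := norm_nonneg h
        nlinarith) (t • w) ⟨t, ht, rfl⟩
  rw [norm_smul, norm_zpow, mem_sphere_zero_iff_norm.1 ht, mul_assoc]
  have : 0 ≤ (R / 2) ^ N := by positivity
  calc _ ≤ (R / 2) ^ N * (C * ((B + 1) * ‖h‖)) := mul_le_mul_of_nonneg_left h6 this
    _ = _ := by ring

/-- The topology induced by `coeff` is itself a locally convex vector space topology for which every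
step map is continuous, so the inductive limit topology is finer. -/
theorem tendsto_coeff {k : ℕ} {Q : InnerProductSpace.Core ℂ (Cn k)}
    {𝓛 : Set (CnDual k)} (N : ℤ) {w : Cn k} (hw : ∀ L ∈ 𝓛, L w ≠ 0)
    {f : ℕ → mero Q 𝓛} {f₀ : mero Q 𝓛}
    (hf : Tendsto f atTop (@nhds _ (meroTopology Q 𝓛) f₀)) :
    Tendsto (fun m => coeff Q N hw (f m)) atTop (𝓝 (coeff Q N hw f₀)) := by
  let τ : TopologicalSpace (mero Q 𝓛) := TopologicalSpace.induced (coeff Q N hw) inferInstance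
  have hle : meroTopology Q 𝓛 ≤ τ := sInf_le ⟨topologicalAddGroup_induced _,
    continuousSMul_induced _, LocallyConvexSpace.induced _, fun n P =>
      continuous_induced_rng.2 (continuous_coeff_comp_stepMap Q N hw n P)⟩
  have h1 : Tendsto f atTop (@nhds _ τ f₀) := hf.mono_right (nhds_mono hle)
  have h2 : Continuous[τ, _] (coeff Q N hw) := continuous_induced_dom
  exact (@Continuous.tendsto _ _ τ _ _ h2 f₀).comp h1

end LinearPoles

/-! ### Invariant directions, and why annihilating a subspace of dependence gives them -/

namespace LinearPoles

open Metric

/-- The space of the directions in which the derivative of the germ `φ` vanishes, described by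
Laurent coefficients. -/
noncomputable def invariantDirections {k : ℕ} {Q : InnerProductSpace.Core ℂ (Cn k)}
    {𝓛 : Set (CnDual k)} (φ : mero Q 𝓛) : Submodule ℂ (Cn k) :=
  ⨅ (N : ℤ) (w : Cn k) (hw : ∀ L ∈ 𝓛, L w ≠ 0),
    LinearMap.ker (coeff Q N hw φ : Cn k →ₗ[ℂ] ℂ)

theorem mem_invariantDirections {k : ℕ} {Q : InnerProductSpace.Core ℂ (Cn k)}
    {𝓛 : Set (CnDual k)} {φ : mero Q 𝓛} {v : Cn k} :
    v ∈ invariantDirections φ ↔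
      ∀ (N : ℤ) (w : Cn k) (hw : ∀ L ∈ 𝓛, L w ≠ 0), coeff Q N hw φ v = 0 := by
  simp [invariantDirections, Submodule.mem_iInf]

/-- The quotient rule with denominators cleared: for analytic `p` and `q`, the right-hand side stays
analytic across the zeros of `q`, so the identity theorem applies to it. -/
theorem fderiv_div_apply_mul_sq {k : ℕ} {p q : Cn k → ℂ} {z : Cn k} (hp : DifferentiableAt ℂ p z)
    (hq : DifferentiableAt ℂ q z) (h0 : q z ≠ 0) (v : Cn k) :
    fderiv ℂ (fun x => p x / q x) z v * q z ^ 2 = q z * fderiv ℂ p z v - p z * fderiv ℂ q z v := by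
  have hl : HasDerivAt (fun s : ℂ => z + s • v) v 0 := by
    simpa using ((hasDerivAt_id (0 : ℂ)).smul_const v).const_add z
  have hz : z + (0 : ℂ) • v = z := by simp
  have key : ∀ F : Cn k → ℂ, DifferentiableAt ℂ F z →
      HasDerivAt (fun s : ℂ => F (z + s • v)) (fderiv ℂ F z v) 0 := fun F hF => by
    have : HasFDerivAt F (fderiv ℂ F z) (z + (0 : ℂ) • v) := by rw [hz]; exact hF.hasFDerivAt
    exact this.comp_hasDerivAt 0 hl
  have h1 := (key p hp).fun_div (key q hq) (by rwa [hz])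
  have h2 := key (fun x => p x / q x) (by simpa only [div_eq_mul_inv] using hp.fun_mul (hq.fun_inv h0))
  rw [h2.unique h1, hz]
  field_simp

/-- The nonzero set of a nontrivial analytic function on a connected open set is dense. -/
theorem subset_closure_inter_ne_zero {k : ℕ} {B : Set (Cn k)} (hB : IsOpen B)
    (hBc : IsPreconnected B) {q : Cn k → ℂ} (hq : AnalyticOnNhd ℂ q B)
    (h0 : ∃ x ∈ B, q x ≠ 0) : B ⊆ closure (B ∩ {x | q x ≠ 0}) := by
  intro y hy
  by_contra hcl
  obtain ⟨x, hx, hqx⟩ := h0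
  refine hqx (hq.eqOn_zero_of_preconnected_of_eventuallyEq_zero hBc hy ?_ hx)
  have h1 : (closure (B ∩ {x | q x ≠ 0}))ᶜ ∈ 𝓝 y := isClosed_closure.isOpen_compl.mem_nhds hcl
  filter_upwards [h1, hB.mem_nhds hy] with x h2 h3
  by_contra h4
  exact h2 (subset_closure ⟨h3, h4⟩)

/-- The open set where `f` is differentiable with vanishing derivative in the direction `v`. -/
def flatSet {k : ℕ} (f : Cn k → ℂ) (v : Cn k) : Set (Cn k) :=
  interior {z | DifferentiableAt ℂ f z ∧ fderiv ℂ f z v = 0}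

theorem isOpen_flatSet {k : ℕ} (f : Cn k → ℂ) (v : Cn k) : IsOpen (flatSet f v) :=
  isOpen_interior

theorem analyticAt_fderiv_apply {k : ℕ} {p : Cn k → ℂ} {z : Cn k} (hp : AnalyticAt ℂ p z)
    (v : Cn k) : AnalyticAt ℂ (fun z => fderiv ℂ p z v) z :=
  ((ContinuousLinearMap.apply ℂ ℂ v).analyticAt _).fun_comp hp.fderiv

/-- On a ball where `f = p / q`, the numerator of the directional derivative is analytic. If it
vanishes on a nonempty open piece it vanishes on the whole ball, and then `f` is flat wherever `q ≠
0`. -/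
theorem IsMeromorphic.exists_subset_closure_flatSet {k : ℕ} {f : Cn k → ℂ} {U : Set (Cn k)}
    (hf : IsMeromorphic f U) (v : Cn k) {z : Cn k} (hz : z ∈ U) :
    ∃ B : Set (Cn k), IsOpen B ∧ z ∈ B ∧
      ((flatSet f v ∩ B).Nonempty → B ⊆ closure (flatSet f v)) := by
  obtain ⟨p, q, hp, hq, hq0, hfpq⟩ := hf z hz
  obtain ⟨r, hr, hB⟩ := Metric.nhds_basis_ball.eventually_iff.1
    ((hp.eventually_analyticAt.and hq.eventually_analyticAt).and hfpq)
  have hc : IsPreconnected (ball z r) := (convex_ball z r).isPreconnected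
  have hpB : AnalyticOnNhd ℂ p (ball z r) := fun x hx => (hB hx).1.1
  have hqB : AnalyticOnNhd ℂ q (ball z r) := fun x hx => (hB hx).1.2
  have hq1 : ∃ x ∈ ball z r, q x ≠ 0 := by
    obtain ⟨x, h1, h2⟩ := (hq0.and_eventually (ball_mem_nhds z hr)).exists
    exact ⟨x, h2, h1⟩
  have hdense := subset_closure_inter_ne_zero isOpen_ball hc hqB hq1
  have hopen : IsOpen (ball z r ∩ {x | q x ≠ 0}) :=
    hqB.continuousOn.isOpen_inter_preimage isOpen_ball isOpen_ne
  have hloc : ∀ x ∈ ball z r ∩ {x | q x ≠ 0}, f =ᶠ[𝓝 x] fun y => p y / q y := fun x hx =>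
    eventually_of_mem (hopen.mem_nhds hx) fun y hy => (hB hy.1).2 hy.2
  let D : Cn k → ℂ := fun x => q x * fderiv ℂ p x v - p x * fderiv ℂ q x v
  have hD : AnalyticOnNhd ℂ D (ball z r) := fun x hx =>
    ((hqB x hx).mul (analyticAt_fderiv_apply (hpB x hx) v)).sub
      ((hpB x hx).mul (analyticAt_fderiv_apply (hqB x hx) v))
  have hDf : ∀ x ∈ ball z r ∩ {x | q x ≠ 0}, fderiv ℂ f x v * q x ^ 2 = D x := fun x hx => by
    rw [(hloc x hx).fderiv_eq]
    exact fderiv_div_apply_mul_sq (hpB x hx.1).differentiableAt (hqB x hx.1).differentiableAt hx.2 v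
  refine ⟨ball z r, isOpen_ball, mem_ball_self hr, ?_⟩
  rintro ⟨y, hyS, hyB⟩
  obtain ⟨x, hxS, hx⟩ := mem_closure_iff_nhds.1 (hdense hyB) _ ((isOpen_flatSet f v).mem_nhds hyS)
  have hD0 : D =ᶠ[𝓝 x] 0 := by
    filter_upwards [(isOpen_flatSet f v).mem_nhds hxS, hopen.mem_nhds hx] with t ht ht'
    rw [← hDf t ht', (interior_subset ht).2, zero_mul, Pi.zero_apply]
  have hDB := hD.eqOn_zero_of_preconnected_of_eventuallyEq_zero hc hx.1 hD0
  refine hdense.trans (closure_mono (interior_maximal (fun t ht => ?_) hopen))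
  refine ⟨(hloc t ht).differentiableAt_iff.2 ((hpB t ht.1).div (hqB t ht.1)
    ht.2).differentiableAt, ?_⟩
  have h1 := hDf t ht
  rw [hDB ht.1, Pi.zero_apply] at h1
  exact (mul_eq_zero.1 h1).resolve_right (pow_ne_zero _ ht.2)

/-- If the derivative of a meromorphic function in some direction vanishes somewhere, then it
vanishes on a dense open set. -/
theorem IsMeromorphic.subset_closure_flatSet {k : ℕ} {f : Cn k → ℂ} {U : Set (Cn k)}
    (hf : IsMeromorphic f U) (hU : IsPreconnected U) (v : Cn k)
    (hne : (flatSet f v ∩ U).Nonempty) : U ⊆ closure (flatSet f v) := by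
  -- Connectedness argument: inside `U`, the interior of the closure of the flat set is nonempty,
  -- open and relatively closed.
  refine (hU.subset_of_closure_inter_subset (u := interior (closure (flatSet f v)))
    isOpen_interior ?_ ?_).trans interior_subset
  · obtain ⟨x, h1, h2⟩ := hne
    exact ⟨x, h2, interior_maximal subset_closure (isOpen_flatSet f v) h1⟩
  · rintro z ⟨hz, hzU⟩
    obtain ⟨B, hB, hzB, h⟩ := hf.exists_subset_closure_flatSet v hzU
    have h1 : z ∈ closure (flatSet f v) :=
      closure_minimal interior_subset isClosed_closure hz
    obtain ⟨x, hx1, hx2⟩ := mem_closure_iff_nhds.1 h1 _ (hB.mem_nhds hzB)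
    exact interior_maximal (h ⟨x, hx2, hx1⟩) hB hzB

/-- Each `L i` kills `v`, so `f` is locally constant along `v` wherever it coincides with `g ∘ L` on
an open set. Moving off the zeros of a local denominator makes `f` differentiable there as well. -/
theorem DependsOn.flatSet_inter_nonempty {k : ℕ} {f : Cn k → ℂ} {U : Set (Cn k)}
    {V : Submodule ℂ (CnDual k)} (h : DependsOn f U V) (hU : IsOpen U) (hf : IsMeromorphic f U)
    {v : Cn k} (hv : ∀ ℓ ∈ V, ℓ v = 0) : (flatSet f v ∩ U).Nonempty := by
  obtain ⟨n, L, W, g, hspan, hW, -, -, ⟨x, hx⟩, hcl⟩ := h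
  have hLc : Continuous fun (z : Cn k) (i : Fin n) => L i z :=
    continuous_pi fun i => (L i).continuous
  have hX : IsOpen (U ∩ (fun z i => L i z) ⁻¹' W) := hU.inter (hW.preimage hLc)
  have hLv : ∀ i, L i v = 0 := fun i => hv _ (hspan ▸ Submodule.subset_span ⟨i, rfl⟩)
  obtain ⟨y, hyX, hyI⟩ := mem_closure_iff_nhds.1 (hcl hx) _ (hX.mem_nhds hx)
  obtain ⟨p, q, hp, hq, hq0, hfpq⟩ := hf y hyX.1
  have hO : IsOpen (U ∩ interior {z | f z = g fun i => L i z}) := hU.inter isOpen_interior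
  obtain ⟨z, hqz, ⟨⟨hpz, hqaz⟩, hfz⟩, hzO⟩ := (hq0.and_eventually
    ((((hp.eventually_analyticAt.and hq.eventually_analyticAt)).and
      (eventually_eventually_nhds.2 hfpq)).and (hO.mem_nhds ⟨hyX.1, hyI⟩))).exists
  refine ⟨z, mem_interior_iff_mem_nhds.2 ?_, hzO.1⟩
  filter_upwards [hpz.eventually_analyticAt, hqaz.eventually_analyticAt,
    hqaz.continuousAt.eventually_ne hqz, eventually_eventually_nhds.2 hfz, hO.mem_nhds hzO]
    with t h1 h2 h3 h4 h5
  have h6 : f =ᶠ[𝓝 t] fun y => p y / q y := by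
    filter_upwards [h4, h2.continuousAt.eventually_ne h3] with s hs hs' using hs hs'
  have h7 : DifferentiableAt ℂ f t := h6.differentiableAt_iff.2 (h1.div h2 h3).differentiableAt
  refine ⟨h7, ?_⟩
  have hl : HasDerivAt (fun s : ℂ => t + s • v) v 0 := by
    simpa using ((hasDerivAt_id (0 : ℂ)).smul_const v).const_add t
  have hz : t + (0 : ℂ) • v = t := by simp
  have h8 : HasDerivAt (fun s : ℂ => f (t + s • v)) (fderiv ℂ f t v) 0 := by
    have : HasFDerivAt f (fderiv ℂ f t) (t + (0 : ℂ) • v) := by rw [hz]; exact h7.hasFDerivAt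
    exact this.comp_hasDerivAt 0 hl
  have h9 : (fun s : ℂ => f (t + s • v)) =ᶠ[𝓝 0] fun _ => g fun i => L i t := by
    have h10 : Tendsto (fun s : ℂ => t + s • v) (𝓝 0) (𝓝 t) := by
      simpa using hl.continuousAt.tendsto
    filter_upwards [h10.eventually (mem_interior_iff_mem_nhds.1 h5.2)] with s hs
    have h11 : f (t + s • v) = g fun i => L i (t + s • v) := hs
    simpa [hLv] using h11
  exact h8.unique ((hasDerivAt_const (0 : ℂ) _).congr_of_eventuallyEq h9)

/-- A direction annihilated by a subspace on which a germ depends is invariant for the germ. -/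
theorem DependsOn.mem_invariantDirections {k : ℕ} {Q : InnerProductSpace.Core ℂ (Cn k)}
    {𝓛 : Set (CnDual k)} {φ : mero Q 𝓛} {f : Cn k → ℂ} {U : Set (Cn k)}
    {V : Submodule ℂ (CnDual k)} (h : DependsOn f U V) (hU : IsOpen U) (hUc : IsConnected U)
    (h0 : 0 ∈ U) (hf : IsMeromorphic f U) (hfφ : (f : Germ (poleFilter 𝓛) ℂ) = φ.1)
    {v : Cn k} (hv : ∀ ℓ ∈ V, ℓ v = 0) : v ∈ invariantDirections φ := by
  have hS := hf.subset_closure_flatSet hUc.isPreconnected v (h.flatSet_inter_nonempty hU hf hv)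
  refine LinearPoles.mem_invariantDirections.2 fun N w hw => ?_
  obtain ⟨p, P, hp, hP, hφ⟩ := exists_eq_div_of_mem_mero φ.2
  obtain ⟨R, hR, han⟩ := exists_analyticAt_div_smul hw hp hP
  have hfF : ∀ᶠ z in poleFilter 𝓛, f z = p z / P z := Germ.coe_eq.1 (hfφ.trans hφ)
  have h1 : Tendsto (fun t : ℂ => t • w) (𝓝 0) (𝓝 0) :=
    Continuous.tendsto' (by fun_prop) _ _ (zero_smul ℂ w)
  have hsmall : ∀ᶠ t in 𝓝[≠] (0 : ℂ), fderiv ℂ (fun z => p z / P z) (t • w) v = 0 := by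
    filter_upwards [eventually_eventually_smul hw hfF, self_mem_nhdsWithin,
      eventually_nhdsWithin_of_eventually_nhds (h1.eventually (hU.mem_nhds h0)),
      eventually_nhdsWithin_of_eventually_nhds (ball_mem_nhds (0 : ℂ) hR)] with t ht ht0 htU htR
    have ha : AnalyticAt ℂ (fun z => p z / P z) (t • w) := han t ht0 (by simpa using htR)
    have hc := (analyticAt_fderiv_apply ha v).continuousAt
    -- The point `t • w` need not lie in the flat set, only in its closure; continuity of the
    -- derivative of `p / P` bridges the gap.
    by_contra hne
    obtain ⟨z, ⟨hz1, hz2⟩, hzS⟩ := mem_closure_iff_nhds.1 (hS htU) _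
      ((hc.eventually_ne hne).and (eventually_eventually_nhds.2 ht))
    have hz3 : f =ᶠ[𝓝 z] fun z => p z / P z := hz2
    have hz4 : fderiv ℂ f z v = 0 := (interior_subset hzS).2
    rw [hz3.fderiv_eq] at hz4
    exact hz1 hz4
  obtain ⟨ε, hε, hεR⟩ := ((eventually_forall_mem_sphere hsmall).and (Ioo_mem_nhdsGT hR)).exists
  rw [coeff_apply_eq_circleIntegral N hw hφ han hεR,
    circleIntegral.integral_congr hεR.1.le (g := fun _ => 0) fun t ht => by simp [hε t ht]]
  simp [circleIntegral]

end LinearPoles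

/-! ### Invariant directions are annihilated by the dependence space -/

namespace LinearPoles

open Metric

/-- A holomorphic function on a disc all of whose Taylor coefficients, given by Cauchy's integrals,
vanish is zero near the centre. -/
theorem eventuallyEq_zero_of_circleIntegral_eq_zero {e : ℂ → ℂ} {ε : ℝ} (hε : 0 < ε)
    (he : DifferentiableOn ℂ e (closedBall 0 ε))
    (h : ∀ N : ℤ, (∮ t in C(0, ε), t ^ N * e t) = 0) : e =ᶠ[𝓝 0] 0 := by
  lift ε to NNReal using hε.le
  have hp := he.hasFPowerSeriesOnBall (by exact_mod_cast hε)
  filter_upwards [ball_mem_nhds (0 : ℂ) hε] with y hy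
  have hs := hp.hasSum (y := y) (by simpa [enorm_lt_coe, ← NNReal.coe_lt_coe] using hy)
  have h0 : ∀ n : ℕ, (cauchyPowerSeries e 0 ε n fun _ => y) = 0 := by
    intro n
    rw [cauchyPowerSeries_apply]
    have : (∮ z in C(0, (ε : ℝ)), (y / (z - 0)) ^ n • (z - 0)⁻¹ • e z) =
        ∮ z in C(0, (ε : ℝ)), y ^ n * (z ^ (-(n : ℤ) - 1) * e z) := by
      refine circleIntegral.integral_congr hε.le fun z hz => ?_
      have hz0 : z ≠ 0 := by
        rw [mem_sphere_zero_iff_norm] at hz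
        exact norm_ne_zero_iff.1 (hz ▸ hε.ne')
      simp only [sub_zero, smul_eq_mul, div_pow, zpow_sub₀ hz0, zpow_neg, zpow_natCast, zpow_one]
      field_simp
    rw [this, circleIntegral.integral_const_mul, h, mul_zero, smul_zero]
  simp only [h0, zero_add] at hs
  exact hs.unique hasSum_zero

/-- The numerator of the derivative of `p / P` in an invariant direction vanishes. -/
theorem derivative_numerator_eq_zero {k : ℕ} {Q : InnerProductSpace.Core ℂ (Cn k)}
    {𝓛 : Set (CnDual k)} (h𝓛 : IsGeneratingSet 𝓛) {φ : mero Q 𝓛} {v : Cn k}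
    (hv : v ∈ invariantDirections φ) {p P : Cn k → ℂ} {R : ℝ}
    (hp : AnalyticOnNhd ℂ p (ball 0 R)) (hR : 0 < R) (hP : P ∈ poleMonoid 𝓛)
    (hφ : φ.1 = ((fun z => p z / P z : Cn k → ℂ) : Germ (poleFilter 𝓛) ℂ)) :
    ∀ z ∈ ball (0 : Cn k) R, P z * fderiv ℂ p z v - p z * fderiv ℂ P z v = 0 := by
  have hPa := fun z => analyticAt_of_mem_poleMonoid hP z
  let D : Cn k → ℂ := fun z => P z * fderiv ℂ p z v - p z * fderiv ℂ P z v
  have hD : AnalyticOnNhd ℂ D (ball 0 R) := fun z hz =>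
    ((hPa z).mul (analyticAt_fderiv_apply (hp z hz) v)).sub
      ((hp z hz).mul (analyticAt_fderiv_apply (hPa z) v))
  obtain ⟨r, hr⟩ := homogeneous_of_mem_poleMonoid hP
  have hgen : ∀ w ∈ ball (0 : Cn k) R, (∀ L ∈ 𝓛, L w ≠ 0) → D w = 0 := by
    intro w hwR hw
    have hPw := ne_zero_of_mem_poleMonoid hP hw
    obtain ⟨ρ, hρ, han⟩ := exists_analyticAt_div_smul hw (hp 0 (mem_ball_self hR)) hP
    let T : Set ℂ := (fun t : ℂ => t • w) ⁻¹' ball 0 R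
    have hTo : IsOpen T := isOpen_ball.preimage (by fun_prop)
    have hTc : Convex ℝ T := (convex_ball (0 : Cn k) R).linear_preimage
      ((LinearMap.toSpanSingleton ℂ (Cn k) w).restrictScalars ℝ)
    have hT0 : (0 : ℂ) ∈ T := by simp [T, hR]
    have hT1 : (1 : ℂ) ∈ T := by simpa [T] using hwR
    have he : AnalyticOnNhd ℂ (fun t : ℂ => D (t • w)) T := by
      refine DifferentiableOn.analyticOnNhd (fun t ht => ?_) hTo
      have hd : DifferentiableAt ℂ D (t • w) := (hD _ ht).differentiableAt
      exact (DifferentiableAt.comp (g := D) (f := fun t : ℂ => t • w) t hd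
        (by fun_prop)).differentiableWithinAt
    obtain ⟨δ, hδ, hδT⟩ := Metric.nhds_basis_closedBall.mem_iff.1 (hTo.mem_nhds hT0)
    let ε := min δ (ρ / 2)
    have hε : 0 < ε := lt_min hδ (half_pos hρ)
    have hερ : ε < ρ := (min_le_right _ _).trans_lt (half_lt_self hρ)
    have h1 : (fun t : ℂ => D (t • w)) =ᶠ[𝓝 0] 0 := by
      refine eventuallyEq_zero_of_circleIntegral_eq_zero hε (he.differentiableOn.mono
        ((closedBall_subset_closedBall (min_le_left _ _)).trans hδT)) fun N => ?_
      -- The shift by `2 * r` absorbs the factor `P (t • w) ^ 2 = t ^ (2 * r) * P w ^ 2` from the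
      -- cleared quotient rule.
      have h2 := mem_invariantDirections.1 hv (N + 2 * r) w hw
      rw [coeff_apply_eq_circleIntegral _ hw hφ han ⟨hε, hερ⟩] at h2
      have h3 : (∮ t in C(0, ε), t ^ N * D (t • w)) = ∮ t in C(0, ε), P w ^ 2 *
          (t ^ (N + 2 * r : ℤ) * fderiv ℂ (fun z => p z / P z) (t • w) v) := by
        refine circleIntegral.integral_congr hε.le fun t ht => ?_
        have ht' := ht
        rw [mem_sphere_zero_iff_norm] at ht
        have ht0 : t ≠ 0 := norm_ne_zero_iff.1 (ht ▸ hε.ne')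
        have htR : t • w ∈ ball (0 : Cn k) R :=
          hδT (closedBall_subset_closedBall (min_le_left _ _) (sphere_subset_closedBall ht'))
        have h4 := fderiv_div_apply_mul_sq (hp _ htR).differentiableAt (hPa (t • w)).differentiableAt
          (by rw [hr]; exact mul_ne_zero (pow_ne_zero _ ht0) hPw) v
        have h5 : D (t • w) = _ := h4.symm
        simp only [h5, hr, zpow_add₀ ht0, zpow_mul, zpow_natCast]
        norm_cast
        ring
      rw [h3, circleIntegral.integral_const_mul, h2, mul_zero]
    -- The identity theorem on the convex set `T` carries the vanishing from `t = 0` to `t = 1`,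
    -- that is, to `w` itself.
    simpa using he.eqOn_zero_of_preconnected_of_eventuallyEq_zero hTc.isPreconnected hT0 h1 hT1
  intro z hz
  by_contra hne
  have hcont : ∀ᶠ y in 𝓝 z, D y ≠ 0 ∧ y ∈ ball (0 : Cn k) R :=
    ((hD z hz).continuousAt.eventually_ne hne).and (isOpen_ball.mem_nhds hz)
  obtain ⟨y, hy, hyg⟩ := mem_closure_iff_nhds.1 (dense_setOf_forall_ne_zero h𝓛 z) _ hcont
  exact hy.1 (hgen y hy.2 hyg)

theorem frequently_ne_zero_of_mem_poleMonoid {k : ℕ} {𝓛 : Set (CnDual k)}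
    (h𝓛 : IsGeneratingSet 𝓛) {P : Cn k → ℂ} (hP : P ∈ poleMonoid 𝓛) (z : Cn k) :
    ∃ᶠ w in 𝓝 z, P w ≠ 0 :=
  (mem_closure_iff_frequently.1 (dense_setOf_forall_ne_zero h𝓛 z)).mono fun _ hw =>
    ne_zero_of_mem_poleMonoid hP hw

/-- The quotient `p / P` is constant on the pieces of complex lines in an invariant direction which
lie in a convex open set free of poles. -/
theorem div_eq_div_add_smul {k : ℕ} {p P : Cn k → ℂ} {v : Cn k} {B : Set (Cn k)} (hB : IsOpen B)
    (hBc : Convex ℝ B) (hp : ∀ z ∈ B, DifferentiableAt ℂ p z)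
    (hPd : ∀ z ∈ B, DifferentiableAt ℂ P z) (hP0 : ∀ z ∈ B, P z ≠ 0)
    (hD : ∀ z ∈ B, P z * fderiv ℂ p z v - p z * fderiv ℂ P z v = 0) {z : Cn k} {s : ℂ}
    (hz : z ∈ B) (hs : z + s • v ∈ B) : p z / P z = p (z + s • v) / P (z + s • v) := by
  let S : Set ℂ := (fun t : ℂ => z + t • v) ⁻¹' B
  have hSo : IsOpen S := hB.preimage (by fun_prop)
  have hSc : Convex ℝ S := (hBc.translate_preimage_right z).linear_preimage
    ((LinearMap.toSpanSingleton ℂ (Cn k) v).restrictScalars ℝ)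
  have hl : ∀ t : ℂ, HasDerivAt (fun t : ℂ => z + t • v) v t := fun t => by
    simpa using ((hasDerivAt_id t).smul_const v).const_add z
  have hd : ∀ t ∈ S, HasDerivAt (fun t : ℂ => p (z + t • v) / P (z + t • v)) 0 t := by
    intro t ht
    have hq : HasDerivAt (fun t : ℂ => P (z + t • v)) (fderiv ℂ P (z + t • v) v) t :=
      (hPd _ ht).hasFDerivAt.comp_hasDerivAt t (hl t)
    have hn : HasDerivAt (fun t : ℂ => p (z + t • v)) (fderiv ℂ p (z + t • v) v) t :=
      (hp _ ht).hasFDerivAt.comp_hasDerivAt t (hl t)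
    have h1 := hn.fun_div hq (hP0 _ ht)
    have h2 : fderiv ℂ p (z + t • v) v * P (z + t • v) -
        p (z + t • v) * fderiv ℂ P (z + t • v) v = 0 := by
      linear_combination hD _ ht
    rwa [h2, zero_div] at h1
  have := hSo.is_const_of_deriv_eq_zero hSc.isPreconnected
    (fun t ht => (hd t ht).differentiableAt.differentiableWithinAt)
    (fun t ht => (hd t ht).deriv) (x := 0) (y := s) (by simpa [S] using hz) hs
  simpa using this

/-- The members of the dependence space of a germ annihilate its invariant directions. -/
theorem apply_eq_zero_of_mem_dep {k : ℕ} {Q : InnerProductSpace.Core ℂ (Cn k)}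
    {𝓛 : Set (CnDual k)} (h𝓛 : IsGeneratingSet 𝓛) {φ : mero Q 𝓛} {v : Cn k}
    (hv : v ∈ invariantDirections φ) {ℓ : CnDual k} (hℓ : ℓ ∈ dep φ.1) : ℓ v = 0 := by
  by_cases hv0 : v = 0
  · rw [hv0, map_zero]
  obtain ⟨i₀, hi₀⟩ := Function.ne_iff.1 hv0
  obtain ⟨p, P, hp, hP, hφ⟩ := exists_eq_div_of_mem_mero φ.2
  obtain ⟨R, hR, hpR⟩ := Metric.nhds_basis_ball.eventually_iff.1 hp.eventually_analyticAt
  have hpR' : AnalyticOnNhd ℂ p (ball 0 R) := fun z hz => hpR hz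
  have hPa := fun z => analyticAt_of_mem_poleMonoid hP z
  have hD := derivative_numerator_eq_zero h𝓛 hv hpR' hR hP hφ
  let e : CnDual k := (v i₀)⁻¹ • ContinuousLinearMap.proj i₀
  have hev : e v = 1 := by
    simpa [e] using inv_mul_cancel₀ (show v i₀ ≠ 0 from hi₀)
  -- A generic base point is needed because `P` may vanish identically on the hyperplane `e = 0`,
  -- where `p / P` could not be restricted.
  obtain ⟨a, haR, hag⟩ := (dense_setOf_forall_ne_zero h𝓛).inter_open_nonempty _ isOpen_ball
    ⟨0, mem_ball_self hR⟩
  have hPa0 : P a ≠ 0 := ne_zero_of_mem_poleMonoid hP hag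
  -- These are the coordinates of the projection `z - e z • v` along `v`; they all vanish at `v`,
  -- and the germ will be shown to depend on their span.
  let L : Fin k → CnDual k := fun i => ContinuousLinearMap.proj i - v i • e
  have hLz : ∀ z : Cn k, (fun i => L i z) = z - e z • v := fun z => by
    ext i
    simp [L, mul_comm]
  have hspan : ∀ ℓ' ∈ Submodule.span ℂ (Set.range L), ℓ' v = 0 := by
    intro ℓ' hℓ'
    have hle : Submodule.span ℂ (Set.range L) ≤
        LinearMap.ker (ContinuousLinearMap.apply ℂ ℂ v : CnDual k →ₗ[ℂ] ℂ) := by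
      refine Submodule.span_le.2 ?_
      rintro _ ⟨i, rfl⟩
      have := congrFun (hLz v) i
      simpa [hev] using this
    simpa using hle hℓ'
  refine hspan ℓ ((Submodule.mem_sInf.1 hℓ) _ ⟨ball 0 R, fun z => p z / P z, isOpen_ball,
    (convex_ball _ _).isConnected ⟨0, mem_ball_self hR⟩, mem_ball_self hR, ?_, hφ.symm, ?_⟩)
  · exact fun z hz => ⟨p, P, hpR hz, hPa z, frequently_ne_zero_of_mem_poleMonoid h𝓛 hP z,
      Eventually.of_forall fun _ _ => rfl⟩
  let b : Cn k := e a • v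
  -- `σ` projects along `v` onto the parallel hyperplane through `a`, so it fixes `a`. The aim is `p
  -- / P = (p / P) ∘ σ`.
  let σ : Cn k → Cn k := fun z => z - e z • v + b
  have hσ : ∀ z, AnalyticAt ℂ σ z := fun z => by
    have h1 : AnalyticAt ℂ (fun z : Cn k => e z • v) z := (e.analyticAt z).smul analyticAt_const
    exact (analyticAt_id.sub h1).add analyticAt_const
  have hσc : Continuous σ := continuous_iff_continuousAt.2 fun z => (hσ z).continuousAt
  have hσa : σ a = a := by simp [σ, b]
  have hball : ∀ y : Cn k, y ∈ ball (-b) R ↔ y + b ∈ ball 0 R := fun y => by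
    simp [mem_ball, dist_eq_norm]
  let X : Set (Cn k) := ball 0 R ∩ σ ⁻¹' ball 0 R
  have hXo : IsOpen X := isOpen_ball.inter (isOpen_ball.preimage hσc)
  have hXc : Convex ℝ X := by
    refine (convex_ball _ _).inter ?_
    have h1 := ((convex_ball (0 : Cn k) R).translate_preimage_left b).linear_preimage
      ((LinearMap.id - (e : Cn k →ₗ[ℂ] ℂ).smulRight v).restrictScalars ℝ)
    exact h1
  have haX : a ∈ X := ⟨haR, by simpa [hσa] using haR⟩
  have hPσ : ∀ z, AnalyticAt ℂ (fun z => P (σ z)) z := fun z => (hPa _).fun_comp (hσ z)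
  have hpσ : ∀ z ∈ X, AnalyticAt ℂ (fun z => p (σ z)) z := fun z hz =>
    AnalyticAt.fun_comp (hpR hz.2) (hσ z)
  have hG : AnalyticOnNhd ℂ (fun z => p z * P (σ z) - p (σ z) * P z) X := fun z hz =>
    ((hpR hz.1).mul (hPσ z)).sub ((hpσ z hz).mul (hPa z))
  -- Near `a` there are no poles and `z`, `σ z` lie on one line in the direction `v`, so the two
  -- quotients agree; cross-multiplied, the identity then extends to all of the convex set `X`.
  have hGa : (fun z => p z * P (σ z) - p (σ z) * P z) =ᶠ[𝓝 a] 0 := by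
    obtain ⟨r, hr, hB⟩ := Metric.nhds_basis_ball.eventually_iff.1
      ((isOpen_ball.eventually_mem haR).and ((hPa a).continuousAt.eventually_ne hPa0))
    have h1 : Tendsto σ (𝓝 a) (𝓝 a) := by
      simpa [hσa] using (hσ a).continuousAt.tendsto
    filter_upwards [ball_mem_nhds a hr, h1.eventually (ball_mem_nhds a hr)] with z hz hσz
    have h2 : σ z = z + (e a - e z) • v := by
      simp only [σ, b, sub_smul]
      abel
    have h3 := div_eq_div_add_smul (v := v) (s := e a - e z) isOpen_ball (convex_ball a r)
      (fun z hz => (hpR (hB hz).1).differentiableAt) (fun z _ => (hPa z).differentiableAt)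
      (fun z hz => (hB hz).2) (fun z hz => hD z (hB hz).1) hz (h2 ▸ hσz)
    rw [← h2, div_eq_div_iff (hB hz).2 (hB hσz).2] at h3
    exact sub_eq_zero.2 h3
  have hG0 := hG.eqOn_zero_of_preconnected_of_eventuallyEq_zero hXc.isPreconnected haX hGa
  have hdense := subset_closure_inter_ne_zero hXo hXc.isPreconnected
    (q := fun z => P z * P (σ z)) (fun z _ => (hPa z).mul (hPσ z))
    ⟨a, haX, by simpa [hσa] using hPa0⟩
  -- Translating by `b` is chosen so that `L z` lies in `ball (-b) R` exactly when `σ z` lies in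
  -- `ball 0 R`; then `g (L z)` is the value of `p / P` at `σ z`.
  refine ⟨k, L, ball (-b) R, fun y => p (y + b) / P (y + b), rfl, isOpen_ball,
    (convex_ball _ _).isConnected ⟨-b, mem_ball_self hR⟩, fun y hy => ?_, ?_, ?_⟩
  · have hadd : AnalyticAt ℂ (fun y : Cn k => y + b) y := analyticAt_id.add analyticAt_const
    refine ⟨fun y => p (y + b), fun y => P (y + b),
      AnalyticAt.fun_comp (hpR ((hball y).1 hy)) hadd, AnalyticAt.fun_comp (hPa _) hadd, ?_,
      Eventually.of_forall fun _ _ => rfl⟩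
    have h1 : Tendsto (fun x : Cn k => x - b) (𝓝 (y + b)) (𝓝 y) :=
      Continuous.tendsto' (by fun_prop) _ _ (by simp)
    refine h1.frequently ((frequently_ne_zero_of_mem_poleMonoid h𝓛 hP (y + b)).mono fun x hx => ?_)
    simpa using hx
  · refine ⟨a, haR, ?_⟩
    rw [Set.mem_preimage, hLz, hball]
    exact haX.2
  · intro z hz
    have hzX : z ∈ X := ⟨hz.1, by
      have h1 := hz.2
      rw [Set.mem_preimage, hLz, hball] at h1
      exact h1⟩
    refine closure_mono (interior_maximal (fun x hx => ?_) ?_) (hdense hzX)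
    · have h1 : p x * P (σ x) - p (σ x) * P x = 0 := hG0 hx.1
      have h2 : P x * P (σ x) ≠ 0 := hx.2
      change p x / P x = p ((fun i => L i x) + b) / P ((fun i => L i x) + b)
      rw [hLz]
      exact (div_eq_div_iff (left_ne_zero_of_mul h2) (right_ne_zero_of_mul h2)).2
        (sub_eq_zero.1 h1)
    · exact hXo.inter (isOpen_ne_fun (continuous_iff_continuousAt.2 fun x =>
        ((hPa x).mul (hPσ x)).continuousAt) continuous_const)

end LinearPoles

/-! ### Duality between vectors and subspaces of linear forms -/

namespace LinearPoles

/-- Every linear form on the dual space is the evaluation at a point. -/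
theorem apply_dual_proj {k : ℕ} (Φ : CnDual k →ₗ[ℂ] ℂ) (ℓ : CnDual k) :
    ℓ (fun i => Φ (ContinuousLinearMap.proj i)) = Φ ℓ := by
  have h1 : ∀ z : Cn k, ℓ z = ∑ i, z i * ℓ (Pi.single i 1) := fun z => by
    conv_lhs => rw [← Finset.univ_sum_single z]
    rw [map_sum]
    refine Finset.sum_congr rfl fun i _ => ?_
    rw [← smul_eq_mul, ← map_smul, ← Pi.single_smul, smul_eq_mul, mul_one]
  have h2 : ℓ = ∑ i, ℓ (Pi.single i 1) • (ContinuousLinearMap.proj i : CnDual k) := by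
    refine ContinuousLinearMap.ext fun z => ?_
    rw [h1 z]
    simp [mul_comm]
  conv_rhs => rw [h2]
  rw [h1, map_sum]
  refine Finset.sum_congr rfl fun i _ => ?_
  rw [map_smul, smul_eq_mul, mul_comm]

/-- Hahn–Banach: a linear form at distance at least `ε` from a subspace of the dual space has
modulus at least `ε` at some point of the unit polydisc annihilated by the subspace. -/
theorem exists_norm_le_one_of_dist_le {k : ℕ} (V : Submodule ℂ (CnDual k)) (ℓ : CnDual k) {ε : ℝ}
    (hε : 0 < ε) (h : ∀ ℓ' ∈ V, ε ≤ dist ℓ' ℓ) :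
    ∃ v : Cn k, ‖v‖ ≤ 1 ∧ (∀ ℓ' ∈ V, ℓ' v = 0) ∧ ε ≤ ‖ℓ v‖ := by
  -- The quotient norm is the distance to `V`, so a norming functional on the quotient, read as
  -- evaluation at a point, has the required properties.
  have hn : ε ≤ ‖(Submodule.Quotient.mk ℓ : CnDual k ⧸ V)‖ := by
    refine le_of_forall_pos_le_add fun δ hδ => ?_
    obtain ⟨x, hx, hxn⟩ := Submodule.Quotient.norm_mk_lt
      (Submodule.Quotient.mk ℓ : CnDual k ⧸ V) hδ
    refine (h _ ((Submodule.Quotient.eq V).1 hx.symm)).trans ((le_of_eq ?_).trans hxn.le)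
    rw [dist_eq_norm, sub_sub_cancel_left, norm_neg]
  obtain ⟨g, hg1, hg⟩ := exists_dual_vector ℂ (Submodule.Quotient.mk ℓ : CnDual k ⧸ V)
    (hε.trans_le hn).ne'
  let v : Cn k := fun i => g (Submodule.Quotient.mk (ContinuousLinearMap.proj i))
  have hgv : ∀ ℓ' : CnDual k, ℓ' v = g (Submodule.Quotient.mk ℓ') := fun ℓ' =>
    apply_dual_proj ((g : CnDual k ⧸ V →ₗ[ℂ] ℂ).comp V.mkQ) ℓ'
  refine ⟨v, (pi_norm_le_iff_of_nonneg zero_le_one).2 fun i => ?_, fun ℓ' hℓ' => ?_, ?_⟩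
  · refine (g.le_opNorm _).trans ?_
    rw [hg1, one_mul]
    refine (Submodule.Quotient.norm_mk_le V _).trans ?_
    refine ContinuousLinearMap.opNorm_le_bound _ zero_le_one fun z => ?_
    simpa using norm_le_pi_norm z i
  · rw [hgv, (Submodule.Quotient.mk_eq_zero V).2 hℓ', map_zero]
  · rw [hgv, hg]
    simpa using hn

/-- Directions annihilated by the dependence space are invariant. -/
theorem mem_invariantDirections_of_forall_mem_dep {k : ℕ}
    {Q : InnerProductSpace.Core ℂ (Cn k)} {𝓛 : Set (CnDual k)} {φ : mero Q 𝓛} {v : Cn k}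
    (hv : ∀ ℓ ∈ dep φ.1, ℓ v = 0) : v ∈ invariantDirections φ := by
  by_contra hvn
  -- `v` is annihilated only by the intersection of the subspaces `V`, perhaps by none of them
  -- individually. So take a form `g` that kills the invariant directions but not `v`, and show that
  -- it lies in every `V`: otherwise some `u` annihilated by `V`, hence invariant, would have `g u ≠
  -- 0`.
  obtain ⟨g, hgv, hg⟩ := Submodule.exists_le_ker_of_notMem hvn
  refine hgv (hv g.toContinuousLinearMap (Submodule.mem_sInf.2 ?_))
  rintro V ⟨U, f, hU, hUc, h0, hf, hfφ, hdep⟩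
  by_contra hgV
  obtain ⟨Φ, hΦg, hΦ⟩ := Submodule.exists_le_ker_of_notMem hgV
  let u : Cn k := fun i => Φ (ContinuousLinearMap.proj i)
  have hu : ∀ ℓ' : CnDual k, ℓ' u = Φ ℓ' := apply_dual_proj Φ
  have h2 := hdep.mem_invariantDirections hU hUc h0 hf hfφ (v := u) fun ℓ' hℓ' => by
    rw [hu]
    exact hΦ hℓ'
  refine hΦg ?_
  rw [← hu]
  exact hg h2

end LinearPoles

/-! ### The compactness argument -/

open LinearPoles in
theorem lemma1p10 {k : ℕ} (Q : InnerProductSpace.Core ℂ (LinearPoles.Cn k))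
    (hQ : LinearPoles.IsRealInner Q) (𝓛 : Set (LinearPoles.CnDual k))
    (h𝓛 : LinearPoles.IsGeneratingSet 𝓛)
    (f : ℕ → LinearPoles.mero Q 𝓛) (f₀ : LinearPoles.mero Q 𝓛)
    (hf : Tendsto f atTop (@nhds _ (LinearPoles.meroTopology Q 𝓛) f₀))
    (ℓ : LinearPoles.CnDual k) (hℓ : ℓ ∈ LinearPoles.dep f₀.1) :
    ∃ (m : ℕ → ℕ) (ℓ' : ℕ → LinearPoles.CnDual k), StrictMono m ∧
      (∀ j, ℓ' j ∈ LinearPoles.dep (f (m j)).1) ∧ Tendsto ℓ' atTop (𝓝 ℓ) := by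
  -- Infinitely many good indices for each tolerance `1 / (j + 1)` suffice: a strictly increasing
  -- choice of indices is then extracted diagonally.
  have key : ∀ j : ℕ, ∃ᶠ n in atTop, ∃ ℓ' ∈ dep (f n).1, dist ℓ' ℓ < 1 / ((j : ℝ) + 1) := by
    intro j hj
    have hε : (0 : ℝ) < 1 / ((j : ℝ) + 1) := by positivity
    obtain ⟨n₀, hn₀⟩ := eventually_atTop.1 hj
    have hex : ∀ n : ℕ, ∃ v : Cn k, ‖v‖ ≤ 1 ∧ (∀ ℓ' ∈ dep (f (n + n₀)).1, ℓ' v = 0) ∧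
        1 / ((j : ℝ) + 1) ≤ ‖ℓ v‖ := fun n =>
      exists_norm_le_one_of_dist_le _ ℓ hε fun ℓ' hℓ' => not_lt.1 fun hlt =>
        hn₀ (n + n₀) (Nat.le_add_left _ _) ⟨ℓ', hℓ', hlt⟩
    choose v hv1 hv2 hv3 using hex
    obtain ⟨u, -, ψ, hψ, hu⟩ := (isCompact_closedBall (0 : Cn k) 1).tendsto_subseq
      fun n => mem_closedBall_zero_iff.2 (hv1 n)
    have hu0 : u ∈ invariantDirections f₀ := by
      refine mem_invariantDirections.2 fun N w hw => ?_
      have h1 : Tendsto (fun n => coeff Q N hw (f (ψ n + n₀))) atTop (𝓝 (coeff Q N hw f₀)) :=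
        Tendsto.comp (g := fun n => coeff Q N hw (f n)) (tendsto_coeff N hw hf)
          ((tendsto_add_atTop_nat n₀).comp hψ.tendsto_atTop)
      -- The form and the vector both vary with `n`; joint continuity of evaluation gives the limit
      -- of the pairing.
      have h2 : Tendsto (fun n => coeff Q N hw (f (ψ n + n₀)) (v (ψ n))) atTop
          (𝓝 (coeff Q N hw f₀ u)) :=
        (isBoundedBilinearMap_apply.continuous.tendsto (coeff Q N hw f₀, u)).comp
          (h1.prodMk_nhds hu)
      have h3 : ∀ n, coeff Q N hw (f (ψ n + n₀)) (v (ψ n)) = 0 := fun n =>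
        mem_invariantDirections.1 (mem_invariantDirections_of_forall_mem_dep (hv2 (ψ n))) N w hw
      simp only [h3] at h2
      exact tendsto_nhds_unique h2 tendsto_const_nhds
    have h4 : Tendsto (fun n => ‖ℓ (v (ψ n))‖) atTop (𝓝 ‖ℓ u‖) :=
      ((ℓ.continuous.tendsto u).comp hu).norm
    have h5 := ge_of_tendsto' h4 fun n => hv3 (ψ n)
    rw [apply_eq_zero_of_mem_dep h𝓛 hu0 hℓ, norm_zero] at h5
    exact absurd hε (not_lt.2 h5)
  obtain ⟨m, hm, hmj⟩ := extraction_forall_of_frequently key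
  choose ℓ' hℓ'1 hℓ'2 using hmj
  refine ⟨m, ℓ', hm, hℓ'1, tendsto_iff_dist_tendsto_zero.2 ?_⟩
  exact squeeze_zero (fun _ => dist_nonneg) (fun j => (hℓ'2 j).le)
    tendsto_one_div_add_atTop_nhds_zero_nat
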